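/- Let $A$ be a finite alphabet. Forests over $A$ are finite ordered sequences of finite ordered unranked trees with node labels in $A$ (the empty forest $0$ is allowed); contexts are forests in which one leaf is replaced by a hole $\Box$; $ps$ denotes the forest obtained by substituting the forest $s$ for the hole of the context $p$, and $pq$ the context obtained by substituting the context $q$. A forest $s$ is a \emph{cca-piece} of a forest $t$, written $s\unlhd t$, if $(s,t)$ lies in the reflexive transitive closure of $$\{(pu,\;pau) : p \text{ a context},\ a\in A,\ u \text{ a tree or the empty forest}\}.$$ A forest language $L$ over $A$ is \emph{cca-piecewise testable} if there is $n>0$ such that membership of a forest $t$ in $L$ depends only on the set of cca-pieces of $t$ having at most $n$ nodes. A forest algebra is a pair $(H,V)$ of monoids, $H$ written additively, with a faithful monoidal left action of $V$ on $H$, such that for every $g\in H$ the monoid $V$ contains elements $\Box+g$ and $g+\Box$ with $(\Box+g)h=h+g$ and $(g+\Box)h=g+h$ for all $h\in H$. A forest language is regular if and only if it equals $\alpha^{-1}(X)$ for a morphism $\alpha$ from the free forest algebra $A^{\Delta}$ (forests and contexts over $A$) to a finite forest algebra $(H,V)$ and a set $X\subseteq H$. \textbf{Corollary.} It is decidable whether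 a regular forest language is cca-piecewise testable. That is, there is one algorithm which, given a finite alphabet $A$, a finite forest algebra $(H,V)$ (by its operation tables), the images $\alpha(a\Box)$, $a\in A$, under a morphism $\alpha:A^{\Delta}\to(H,V)$, and a set $X\subseteq H$, decides whether the language $\alpha^{-1}(X)$ is cca-piecewise testable. -/

import Mathlib

namespace ForestLang

/-! ### Forests and contexts over an alphabet -/

/-- Finite unranked ordered trees with labels in `A`: a root label and the ordered list of the
subtrees below the root (`node a []` is the one-node tree `a`). -/
inductive Tree (A : Type*) : Type _
  | node (a : A) (children : List (Tree A)) : Tree A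

/-- Forests are finite ordered sequences of trees. -/
def Forest (A : Type*) : Type _ := List (Tree A)

/-- The monoid of forests: `0` is the empty forest and `+` is concatenation. -/
instance {A : Type*} : Add (Forest A) := ⟨fun s t => List.append s t⟩

instance {A : Type*} : Zero (Forest A) := ⟨([] : List (Tree A))⟩

instance {A : Type*} : AddMonoid (Forest A) where
  add_assoc s t u := List.append_assoc s t u
  zero_add s := List.nil_append s
  add_zero s := List.append_nil s
  nsmul := nsmulRec

/-- A tree seen as a forest with one root. -/
def Tree.toForest {A : Type*} (t : Tree A) : Forest A := ([t] : List (Tree A))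

/-- The tree `a s` whose root is labelled `a` and whose children are the roots of `s`. -/
def Tree.cons {A : Type*} (a : A) (s : Forest A) : Tree A := Tree.node a s

mutual
/-- The number of nodes of a tree. -/
def Tree.size {A : Type*} : Tree A → ℕ
  | .node _ ts => Tree.sizeList ts + 1
/-- The number of nodes of a list of trees. -/
def Tree.sizeList {A : Type*} : List (Tree A) → ℕ
  | [] => 0
  | t :: ts => Tree.size t + Tree.sizeList ts
end

/-- The number of nodes of a forest. -/
def Forest.size {A : Type*} (s : Forest A) : ℕ := Tree.sizeList s

/-- Contexts: forests with exactly one hole, which is a leaf.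
`hole l r` is `l + □ + r`, and `node l a p r` is `l + a p + r`. -/
inductive Context (A : Type*) : Type _
  | hole (l r : Forest A) : Context A
  | node (l : Forest A) (a : A) (p : Context A) (r : Forest A) : Context A

namespace Context

variable {A : Type*}

/-- Substitution `p s` of a forest for the hole of a context. -/
def subst : Context A → Forest A → Forest A
  | hole l r, s => l + s + r
  | node l a p r, s => l + (Tree.cons a (p.subst s)).toForest + r

/-- The context `l + p + r`. -/
def surround (l : Forest A) : Context A → Forest A → Context A
  | hole l' r', r => hole (l + l') (r' + r)
  | node l' a p r', r => node (l + l') a p (r' + r)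

/-- Composition `q p` of contexts: the hole of `q` is replaced by `p`. -/
def comp : Context A → Context A → Context A
  | hole l r, p => surround l p r
  | node l a q r, p => node l a (q.comp p) r

theorem surround_surround (l l' : Forest A) (p : Context A) (r' r : Forest A) :
    surround l (surround l' p r') r = surround (l + l') p (r' + r) := by
  cases p <;> simp [surround, add_assoc]

theorem surround_comp (l : Forest A) (q p : Context A) (r : Forest A) :
    (surround l q r).comp p = surround l (q.comp p) r := by
  cases q with
  | hole l' r' => exact (surround_surround l l' p r' r).symm
  | node l' a q r' => rfl

theorem subst_surround (l : Forest A) (p : Context A) (r s : Forest A) :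
    (surround l p r).subst s = l + p.subst s + r := by
  cases p <;> simp [surround, subst, add_assoc]

/-- The monoid of contexts: `1` is the empty context `□`, multiplication is composition. -/
instance : Monoid (Context A) where
  mul q p := q.comp p
  one := hole 0 0
  mul_assoc p q r := by
    change (p.comp q).comp r = p.comp (q.comp r)
    induction p with
    | hole l r => simp [comp, surround_comp]
    | node l a p r ih => simp [comp, ih]
  one_mul p := by
    change (hole 0 0).comp p = p
    cases p <;> simp [comp, surround]
  mul_one p := by
    change p.comp (hole 0 0) = p
    induction p with
    | hole l r => simp [comp, surround]
    | node l a p r ih => simp [comp, ih]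

/-- Contexts act on forests by substitution. -/
instance : MulAction (Context A) (Forest A) where
  smul p s := p.subst s
  one_smul s := by
    change (hole 0 0).subst s = s
    simp [subst]
  mul_smul p q s := by
    change (p.comp q).subst s = p.subst (q.subst s)
    induction p with
    | hole l r => simp [comp, subst, subst_surround]
    | node l a p r ih => simp [comp, subst, ih]

/-- The context `a □`. -/
def letter (a : A) : Context A := node 0 a 1 0

end Context

/-! ### Closest-common-ancestor pieces -/

/-- A forest that consists of one tree. -/
def Forest.IsTree {A : Type*} (s : Forest A) : Prop := ∃ t : Tree A, s = t.toForest

/-- One removal step: `s = p t` is obtained from `s' = p a t` by removing the node `a`, where `t`,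
the forest below that node, is a tree or empty. -/
def CCAStep {A : Type*} (s s' : Forest A) : Prop :=
  ∃ (p : Context A) (a : A) (t : Forest A),
    (t.IsTree ∨ t = 0) ∧ s = p • t ∧ s' = (p * Context.letter a) • t

/-- `s` is a cca-piece of `t`. -/
def CCAPiece {A : Type*} (s t : Forest A) : Prop := Relation.ReflTransGen CCAStep s t

/-- A forest language is cca-piecewise testable if, for some `n > 0`, membership of a forest
depends only on the set of its cca-pieces of size at most `n`. -/
def IsCCAPiecewiseTestable {A : Type*} (L : Set (Forest A)) : Prop :=
  ∃ n : ℕ, 0 < n ∧ ∀ t t' : Forest A,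
    {s : Forest A | s.size ≤ n ∧ CCAPiece s t} = {s : Forest A | s.size ≤ n ∧ CCAPiece s t'} →
      (t ∈ L ↔ t' ∈ L)

/-! ### Forest algebras -/

/-- The pair of monoids `(H, V)`, with `V` acting on `H`, is a forest algebra: the action is
faithful, and `V` contains elements `□ + g` and `g + □` for all `g` in `H`. -/
class ForestAlgebra (H V : Type*) [AddMonoid H] [Monoid V] [MulAction V H] : Prop
    extends FaithfulSMul V H where
  exists_hole_add : ∀ g : H, ∃ v : V, ∀ h : H, v • h = h + g
  exists_add_hole : ∀ g : H, ∃ v : V, ∀ h : H, v • h = g + h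

/-- Morphisms from the free forest algebra of forests and contexts over `A` to `(H, V)`. -/
structure FreeMorphism (A H V : Type*) [AddMonoid H] [Monoid V] [MulAction V H] where
  onForest : Forest A →+ H
  onContext : Context A →* V
  map_smul : ∀ (p : Context A) (s : Forest A), onForest (p • s) = onContext p • onForest s

/-- The forest language `α⁻¹(X)` that is recognized by the morphism `α` and the set `X`. -/
def FreeMorphism.language {A H V : Type*} [AddMonoid H] [Monoid V] [MulAction V H]
    (α : FreeMorphism A H V) (X : Set H) : Set (Forest A) :=
  {s | α.onForest s ∈ X}

/-! ### Presenting a recognized language as a finite input -/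

/-- Inputs of the decision problem. The components are, in this order: the addition table of `H`,
the index of `0`, the multiplication table of `V`, the index of `□`, the table of the action of `V`
on `H`, the list of the images of the contexts `a □`, and the characteristic sequence of the
accepting set. -/
abbrev Input : Type :=
  List (List ℕ) × ℕ × List (List ℕ) × ℕ × List (List ℕ) × List ℕ × List Bool

open Classical in
/-- The input that describes a finite forest algebra `(H, V)`, a morphism `α` into it and an
accepting set `X`, relative to enumerations of the alphabet, of `H` and of `V`. -/
noncomputable def FreeMorphism.toInput {A H V : Type*} [AddMonoid H] [Monoid V] [MulAction V H]
    {k n m : ℕ} (letters : Fin k ≃ A) (forests : Fin n ≃ H) (contexts : Fin m ≃ V)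
    (α : FreeMorphism A H V) (X : Set H) : Input :=
  (List.ofFn fun i => List.ofFn fun j => (forests.symm (forests i + forests j) : ℕ),
   (forests.symm 0 : ℕ),
   List.ofFn fun i => List.ofFn fun j => (contexts.symm (contexts i * contexts j) : ℕ),
   (contexts.symm 1 : ℕ),
   List.ofFn fun i => List.ofFn fun j => (forests.symm (contexts i • forests j) : ℕ),
   List.ofFn fun i => (contexts.symm (α.onContext (Context.letter (letters i))) : ℕ),
   List.ofFn fun i => decide (forests i ∈ X))

end ForestLang

-- Being a cca-piece is the same as embedding homeomorphically (`CCAPiece.emb`, `CCAPiece.of_emb`),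
-- and over a finite alphabet embedding is a well-quasi-order (Kruskal). The language is testable
-- exactly when its syntactic congruence satisfies two families of identities
-- (`isCCAPiecewiseTestable_iff`): a forest with idempotent value absorbs, on both sides, every
-- forest that embeds into it, and a context with idempotent action does the same with contexts,
-- when applied to a tree or to `0`.
--
-- Necessity: if `z` is idempotent and `s` embeds into `z`, the chain `z ≤ z + s ≤ z + z ≤ z + z + s
-- ≤ ...` alternates between two values, whereas only finitely many small pieces can appear along
-- it.
--
-- Sufficiency: the identities bound the number of class changes along increasing chains
-- (`PiecewiseCongruence.bounded`). The forests that start no chain with `n` changes form an upward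
-- closed set with a finite basis, and the pieces in these finitely many bases determine the class
-- (`BoundedAlternation.exists_size`). The bound is proved by Noetherian induction on downward
-- closed sets. In the irreducible cases a monoid of forests or contexts acts on the set, it has a
-- zero modulo the congruence (`List.exists_zero`), and forests that contain many copies of this
-- zero are under control.
--
-- Decidability: the identities speak of infinitely many forests, but embedding is generated by
-- finitely many rules, which can be read on values. Testability thus amounts to the existence of
-- relations on `H` and `V` that are closed under these rules and compatible with `X`
-- (`isCCAPiecewiseTestable_iff_certificate`). There are finitely many candidates, so a bounded,
-- primitive recursive search decides.

/-! ### Subsequence embeddings of lists -/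

namespace List.SublistForall₂

variable {α : Type*} {R : α → α → Prop}

theorem append {a b c d : List α} (h : SublistForall₂ R a b) (h' : SublistForall₂ R c d) :
    SublistForall₂ R (a ++ c) (b ++ d) := by
  induction h with
  | nil =>
    rename_i l
    induction l with
    | nil => exact h'
    | cons x l ih => exact .cons_right ih
  | cons hr _ ih => exact .cons hr ih
  | cons_right _ ih => exact .cons_right ih

theorem exists_mem {s t : List α} (h : SublistForall₂ R s t) {x : α} (hx : x ∈ s) :
    ∃ y ∈ t, R x y := by
  induction h with
  | nil => simp at hx
  | cons hr _ ih =>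
    rcases List.mem_cons.1 hx with rfl | hx
    · exact ⟨_, by simp, hr⟩
    · obtain ⟨y, hy, h⟩ := ih hx
      exact ⟨y, by simp [hy], h⟩
  | cons_right _ ih =>
    obtain ⟨y, hy, h⟩ := ih hx
    exact ⟨y, by simp [hy], h⟩

theorem length_le {s t : List α} (h : SublistForall₂ R s t) : s.length ≤ t.length := by
  induction h with
  | nil => simp
  | cons _ _ ih => simpa using ih
  | cons_right _ ih => simp; omega

theorem singleton_of_mem {x y : α} {t : List α} (hy : y ∈ t) (h : R x y) :
    SublistForall₂ R [x] t := by
  induction t with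
  | nil => simp at hy
  | cons z t ih =>
    rcases List.mem_cons.1 hy with rfl | hy
    · exact .cons h .nil
    · exact .cons_right (ih hy)

theorem split_right {s t₁ t₂ : List α} (h : SublistForall₂ R s (t₁ ++ t₂)) :
    ∃ s₁ s₂, s = s₁ ++ s₂ ∧ SublistForall₂ R s₁ t₁ ∧ SublistForall₂ R s₂ t₂ := by
  induction t₁ generalizing s with
  | nil => exact ⟨[], s, rfl, .nil, h⟩
  | cons x t₁ ih =>
    cases h with
    | nil => exact ⟨[], [], rfl, .nil, .nil⟩
    | cons hr h =>
      obtain ⟨s₁, s₂, rfl, h₁, h₂⟩ := ih h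
      exact ⟨_ :: s₁, s₂, rfl, .cons hr h₁, h₂⟩
    | cons_right h =>
      obtain ⟨s₁, s₂, rfl, h₁, h₂⟩ := ih h
      exact ⟨s₁, s₂, rfl, .cons_right h₁, h₂⟩

theorem split_left {s₁ s₂ t : List α} (h : SublistForall₂ R (s₁ ++ s₂) t) :
    ∃ t₁ t₂, t = t₁ ++ t₂ ∧ SublistForall₂ R s₁ t₁ ∧ SublistForall₂ R s₂ t₂ := by
  induction t generalizing s₁ with
  | nil =>
    have := h.length_le
    simp only [List.length_append, List.length_nil, nonpos_iff_eq_zero, Nat.add_eq_zero_iff,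
      List.length_eq_zero_iff] at this
    obtain ⟨rfl, rfl⟩ := this
    exact ⟨[], [], rfl, .nil, .nil⟩
  | cons x t ih =>
    cases s₁ with
    | nil => exact ⟨[], x :: t, rfl, .nil, h⟩
    | cons y s₁ =>
      cases h with
      | cons hr h =>
        obtain ⟨t₁, t₂, rfl, h₁, h₂⟩ := ih h
        exact ⟨x :: t₁, t₂, rfl, .cons hr h₁, h₂⟩
      | cons_right h =>
        obtain ⟨t₁, t₂, rfl, h₁, h₂⟩ := ih (s₁ := y :: s₁) h
        exact ⟨x :: t₁, t₂, rfl, .cons_right h₁, h₂⟩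

/-- Transitivity is required only through members of `u`, so that the lemma applies inside an
induction on trees, where it is known for children alone. -/
theorem trans_of_mem {s t u : List α}
    (hR : ∀ z ∈ u, ∀ x y, R x y → R y z → R x z)
    (h : SublistForall₂ R s t) (h' : SublistForall₂ R t u) : SublistForall₂ R s u := by
  induction h' generalizing s with
  | nil => cases h; exact .nil
  | cons hr _ ih =>
    have ih' := fun {s} => @ih s (fun z hz => hR z (by simp [hz]))
    cases h with
    | nil => exact .nil
    | cons hr' h => exact .cons (hR _ (by simp) _ _ hr' hr) (ih' h)
    | cons_right h => exact .cons_right (ih' h)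
  | cons_right _ ih => exact .cons_right (ih (fun z hz => hR z (by simp [hz])) h)

theorem refl_of_mem {s : List α} (hR : ∀ x ∈ s, R x x) : SublistForall₂ R s s := by
  induction s with
  | nil => exact .nil
  | cons x s ih => exact .cons (hR x (by simp)) (ih fun y hy => hR y (by simp [hy]))

/-- A list of length at most one that embeds into `t` embeds into such a factor of `t`. -/
theorem split_of_length_le_one {s t : List α} (h : SublistForall₂ R s t) (hs : s.length ≤ 1) :
    ∃ t₁ t₂ t₃, t = t₁ ++ t₂ ++ t₃ ∧ t₂.length ≤ 1 ∧ SublistForall₂ R s t₂ := by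
  rcases s with _ | ⟨x, _ | ⟨y, s⟩⟩
  · exact ⟨t, [], [], by simp, by simp, .nil⟩
  · obtain ⟨y, hy, hr⟩ := h.exists_mem (x := x) (by simp)
    obtain ⟨t₁, t₃, rfl⟩ := List.append_of_mem hy
    exact ⟨t₁, [y], t₃, by simp, by simp, .cons hr .nil⟩
  · simp at hs

end List.SublistForall₂

namespace ForestLang

open List (SublistForall₂)

variable {A : Type*}

/-! ### Homeomorphic embeddings -/

theorem Tree.sizeList_append (s t : List (Tree A)) :
    Tree.sizeList (s ++ t) = Tree.sizeList s + Tree.sizeList t := by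
  induction s with
  | nil => simp [Tree.sizeList]
  | cons x s ih => simp [Tree.sizeList, ih, add_assoc]

theorem Tree.size_pos (t : Tree A) : 0 < t.size := by cases t; simp [Tree.size]

theorem Tree.size_le_of_mem {t : Tree A} {s : List (Tree A)} (h : t ∈ s) :
    t.size ≤ Tree.sizeList s := by
  obtain ⟨s₁, s₂, rfl⟩ := List.append_of_mem h
  simp [Tree.sizeList_append, Tree.sizeList]
  omega

theorem Tree.size_lt_of_mem {t : Tree A} {a : A} {s : List (Tree A)} (h : t ∈ s) :
    t.size < (Tree.node a s).size := by
  simpa [Tree.size, Nat.lt_succ_iff] using Tree.size_le_of_mem h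

theorem Tree.induction_mem {P : Tree A → Prop}
    (h : ∀ a s, (∀ t ∈ s, P t) → P (Tree.node a s)) (t : Tree A) : P t := by
  induction hn : t.size using Nat.strong_induction_on generalizing t with
  | _ n ih =>
    subst hn
    cases t with
    | node a s => exact h a s fun t ht => ih _ (Tree.size_lt_of_mem ht) t rfl

/-- The homeomorphic embedding order on trees. -/
inductive Tree.Emb : Tree A → Tree A → Prop
  | root (a : A) {s t : List (Tree A)} : SublistForall₂ Tree.Emb s t →
      Tree.Emb (.node a s) (.node a t)
  | desc (a : A) {s t : Tree A} {ts : List (Tree A)} : t ∈ ts → Tree.Emb s t →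
      Tree.Emb s (.node a ts)

/-- The homeomorphic embedding order on forests. -/
abbrev FEmb : List (Tree A) → List (Tree A) → Prop := SublistForall₂ Tree.Emb

theorem Tree.Emb.refl (t : Tree A) : Tree.Emb t t := by
  induction t using Tree.induction_mem with
  | h a s ih => exact .root a (.refl_of_mem ih)

theorem Tree.Emb.trans {s t u : Tree A} (h : Tree.Emb s t) (h' : Tree.Emb t u) :
    Tree.Emb s u := by
  induction u using Tree.induction_mem generalizing s t with
  | h a us ih =>
    cases h' with
    | desc _ hm h' => exact .desc _ hm (ih _ hm h h')
    | root _ h' =>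
      cases h with
      | root _ h => exact .root _ (h.trans_of_mem (fun z hz x y hxy hyz => ih z hz hxy hyz) h')
      | desc _ hm h =>
        obtain ⟨v, hv, htv⟩ := h'.exists_mem hm
        exact .desc _ hv (ih v hv h htv)

instance : IsPreorder (Tree A) Tree.Emb where
  refl := Tree.Emb.refl
  trans _ _ _ := Tree.Emb.trans

theorem FEmb.refl (s : List (Tree A)) : FEmb s s := .refl_of_mem fun _ _ => .refl _

theorem FEmb.trans {s t u : List (Tree A)} (h : FEmb s t) (h' : FEmb t u) : FEmb s u :=
  h.trans_of_mem (fun _ _ _ _ => .trans) h'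

instance : IsPreorder (List (Tree A)) FEmb where
  refl := FEmb.refl
  trans _ _ _ := FEmb.trans

theorem FEmb.node (a : A) {s t : List (Tree A)} (h : FEmb s t) : FEmb [.node a s] [.node a t] :=
  .cons (.root a h) .nil

theorem FEmb.surround {s l t r : List (Tree A)} (h : FEmb s t) : FEmb s (l ++ t ++ r) := by
  simpa using (List.SublistForall₂.append (.nil : FEmb [] l) h).append (.nil : FEmb [] r)

/-- The source of every hypothesis `length ≤ 1` below: a new root may be put on top of a tree or of
the empty forest, but above several trees it would become a new closest common ancestor. -/
theorem FEmb.of_length_le_one (a : A) {s t : List (Tree A)} (hs : s.length ≤ 1) (h : FEmb s t) :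
    FEmb s [.node a t] := by
  rcases s with _ | ⟨x, _ | ⟨y, s⟩⟩
  · exact .nil
  · obtain ⟨y, hy, hr⟩ := h.exists_mem (x := x) (by simp)
    exact .cons (.desc a hy hr) .nil
  · simp at hs

/-! ### Kruskal's theorem -/

/-- Nash-Williams' argument: in a bad sequence minimal for size, the children of its terms are
well-quasi-ordered. By Higman's lemma so are the lists of children, and finitely many labels then
yield a good pair. -/
theorem Tree.wellQuasiOrdered [Finite A] : WellQuasiOrdered (Tree.Emb (A := A)) := by
  rw [← Set.partiallyWellOrderedOn_univ_iff,
    Set.PartiallyWellOrderedOn.iff_not_exists_isMinBadSeq Tree.size]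
  rintro ⟨f, ⟨-, hbad⟩, hmin⟩
  choose lab ch hf using fun n => (show ∃ a s, f n = Tree.node a s from by
    cases h : f n with | node a s => exact ⟨a, s, rfl⟩)
  have hS : Set.PartiallyWellOrderedOn {t | ∃ n, t ∈ ch n} (Tree.Emb (A := A)) := by
    rw [Set.PartiallyWellOrderedOn.iff_forall_not_isBadSeq]
    rintro g ⟨hg, hgb⟩
    choose ν hν using hg
    -- Splicing the bad sequence `g` of children at the least index `ν i` keeps badness: a term `f
    -- m` with `m < ν i` below some child would lie below the parent of that child, whose index is
    -- larger than `m`.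
    obtain ⟨i, hi⟩ : ∃ i, ∀ j, ν i ≤ ν j :=
      ⟨Function.argmin ν, fun j => Function.argmin_le ν j⟩
    refine hmin (ν i) (fun m => if m < ν i then f m else g (i + (m - ν i)))
      (fun m hm => by simp [hm]) ?_ ⟨by simp, ?_⟩
    · simpa [hf (ν i)] using Tree.size_lt_of_mem (hν i)
    · intro m n hmn
      by_cases hn : n < ν i
      · simpa [hn, hmn.trans hn] using hbad m n hmn
      · by_cases hm : m < ν i
        · simp only [hm, hn, if_true, if_false]
          intro h
          refine hbad m (ν (i + (n - ν i))) (hm.trans_le (hi _)) ?_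
          rw [hf (ν (i + (n - ν i)))]
          exact .desc _ (hν _) h
        · simp only [hm, hn, if_false]
          exact hgb _ _ (by omega)
  have hF := Set.PartiallyWellOrderedOn.partiallyWellOrderedOn_sublistForall₂ _ hS
  have hA : Set.PartiallyWellOrderedOn (Set.univ : Set A) (· = ·) :=
    Set.finite_univ.partiallyWellOrderedOn
  obtain ⟨m, n, hmn, h₁, h₂⟩ := (hA.prod hF).exists_lt (f := fun n => (lab n, ch n))
    (fun n => ⟨trivial, fun t ht => ⟨n, ht⟩⟩)
  apply hbad m n hmn
  rw [hf m, hf n]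
  simp only at h₁ h₂
  rw [h₁]
  exact .root _ h₂

theorem FEmb.wellQuasiOrdered [Finite A] : WellQuasiOrdered (FEmb (A := A)) := by
  have := Set.PartiallyWellOrderedOn.partiallyWellOrderedOn_sublistForall₂ _
    (Set.partiallyWellOrderedOn_univ_iff.2 (Tree.wellQuasiOrdered (A := A)))
  rw [← Set.partiallyWellOrderedOn_univ_iff]
  exact this.mono fun _ _ => by simp

/-- Every set has a finite subset of minimal elements below all its elements. -/
theorem _root_.WellQuasiOrdered.exists_finset_basis {α : Type*} {r : α → α → Prop}
    [IsPreorder α r] (h : WellQuasiOrdered r) (U : Set α) :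
    ∃ B : Finset α, (∀ s ∈ B, s ∈ U) ∧ ∀ t ∈ U, ∃ s ∈ B, r s t := by
  classical
  by_contra hcon
  push Not at hcon
  -- Without a finite basis, each finite part of `U` misses some element of `U`; choosing such
  -- elements greedily builds a bad sequence.
  have key : ∀ l : List α, (∀ s ∈ l, s ∈ U) → ∃ t ∈ U, ∀ s ∈ l, ¬ r s t := fun l hl => by
    simpa using hcon l.toFinset (by simpa using hl)
  have : ∃ f : ℕ → α, ∀ n, f n ∈ U ∧ ∀ m < n, ¬ r (f m) (f n) := by
    obtain ⟨g, hg⟩ : ∃ g : List α → α, ∀ l, (∀ s ∈ l, s ∈ U) → g l ∈ U ∧ ∀ s ∈ l, ¬ r s (g l) := by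
      obtain ⟨x, -⟩ := key [] (by simp)
      have : Nonempty α := ⟨x⟩
      choose! g hg using key
      exact ⟨g, hg⟩
    let L : ℕ → List α := fun n => Nat.rec [] (fun _ l => g l :: l) n
    have hL : ∀ n, ∀ s ∈ L n, s ∈ U := by
      intro n
      induction n with
      | zero => simp [L]
      | succ n ih =>
        intro s hs
        rcases List.mem_cons.1 hs with rfl | hs
        · exact (hg _ ih).1
        · exact ih s hs
    have hmem : ∀ m n, m < n → g (L m) ∈ L n := by
      intro m n hmn
      induction n with
      | zero => omega
      | succ n ih =>
        rcases Nat.lt_succ_iff_lt_or_eq.1 hmn with h | rfl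
        · exact List.mem_cons_of_mem _ (ih h)
        · exact List.mem_cons_self
    exact ⟨fun n => g (L n), fun n => ⟨(hg _ (hL n)).1, fun m hm => (hg _ (hL n)).2 _ (hmem m n hm)⟩⟩
  obtain ⟨f, hf⟩ := this
  obtain ⟨m, n, hmn, hr⟩ := h f
  exact (hf n).2 m hmn hr

/-! ### Elementary contexts -/

/-- The elementary context `b (l + □ + r)` is represented by `(l, b, r)`. -/
abbrev Step (A : Type*) := List (Tree A) × A × List (Tree A)

/-- Substitution of a forest in an elementary context. -/
def Step.subst (e : Step A) (s : List (Tree A)) : List (Tree A) := [.node e.2.1 (e.1 ++ s ++ e.2.2)]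

/-- Embedding of elementary contexts. -/
def Step.Emb (e e' : Step A) : Prop := FEmb e.1 e'.1 ∧ e.2.1 = e'.2.1 ∧ FEmb e.2.2 e'.2.2

instance : IsPreorder (Step A) Step.Emb where
  refl _ := ⟨.refl _, rfl, .refl _⟩
  trans _ _ _ h h' := ⟨h.1.trans h'.1, h.2.1.trans h'.2.1, h.2.2.trans h'.2.2⟩

theorem Step.wellQuasiOrdered [Finite A] : WellQuasiOrdered (Step.Emb (A := A)) := by
  have hA : WellQuasiOrdered (α := A) (· = ·) := Finite.wellQuasiOrdered _
  exact FEmb.wellQuasiOrdered.prod (hA.prod FEmb.wellQuasiOrdered)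

/-- Substitution of a forest in a composition of elementary contexts. -/
def act (q : List (Step A)) (s : List (Tree A)) : List (Tree A) := q.foldr Step.subst s

@[simp] theorem act_nil (s : List (Tree A)) : act [] s = s := rfl

@[simp] theorem act_cons (e : Step A) (q : List (Step A)) (s : List (Tree A)) :
    act (e :: q) s = e.subst (act q s) := rfl

theorem act_append (p q : List (Step A)) (s : List (Tree A)) :
    act (p ++ q) s = act p (act q s) := by simp [act]

@[simp] theorem Step.length_subst (e : Step A) (s : List (Tree A)) : (e.subst s).length = 1 := rfl

theorem length_act_le_one (q : List (Step A)) {s : List (Tree A)} (hs : s.length ≤ 1) :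
    (act q s).length ≤ 1 := by
  cases q with
  | nil => exact hs
  | cons e q => simp

theorem Step.sizeList_subst (e : Step A) (s : List (Tree A)) :
    Tree.sizeList s < Tree.sizeList (e.subst s) := by
  simp [Step.subst, Tree.sizeList, Tree.size, Tree.sizeList_append]
  omega

/-- Embedding of compositions of elementary contexts. -/
abbrev CEmb : List (Step A) → List (Step A) → Prop := SublistForall₂ Step.Emb

theorem CEmb.refl (q : List (Step A)) : CEmb q q := .refl_of_mem fun _ _ => refl_of Step.Emb _

theorem CEmb.trans {p q r : List (Step A)} (h : CEmb p q) (h' : CEmb q r) : CEmb p r :=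
  h.trans_of_mem (fun _ _ _ _ => trans_of Step.Emb) h'

theorem Step.Emb.subst {e e' : Step A} {s t : List (Tree A)} (he : e.Emb e') (h : FEmb s t) :
    FEmb (e.subst s) (e'.subst t) := by
  obtain ⟨h₁, h₂, h₃⟩ := he
  rw [Step.subst, Step.subst, h₂]
  exact .node _ ((h₁.append h).append h₃)

theorem Step.emb_subst (e : Step A) {s t : List (Tree A)} (hs : s.length ≤ 1) (h : FEmb s t) :
    FEmb s (e.subst t) :=
  .of_length_le_one _ hs h.surround

/-- Skipped elementary contexts of `q` cost nothing, because what lies inside them has at most one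
root. -/
theorem CEmb.act {p q : List (Step A)} {s t : List (Tree A)} (hq : CEmb p q) (hs : s.length ≤ 1)
    (h : FEmb s t) : FEmb (act p s) (act q t) := by
  induction hq with
  | nil =>
    rename_i q
    induction q with
    | nil => exact h
    | cons e q ih => exact e.emb_subst hs ih
  | cons he _ ih => exact he.subst ih
  | cons_right _ ih => exact Step.emb_subst _ (length_act_le_one _ hs) ih

theorem FEmb.act (q : List (Step A)) {s t : List (Tree A)} (h : FEmb s t) :
    FEmb (act q s) (act q t) := by
  induction q with
  | nil => exact h
  | cons e q ih => exact (refl_of Step.Emb e).subst ih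

/-- A tree above `q s` is a composition of a context above `q` and a tree above `s`. -/
theorem FEmb.factor {q : List (Step A)} {s t : List (Tree A)} (hs : s.length ≤ 1)
    (ht : t.length ≤ 1) (h : FEmb (ForestLang.act q s) t) :
    ∃ p t', t = ForestLang.act p t' ∧ CEmb q p ∧ t'.length ≤ 1 ∧ FEmb s t' := by
  induction hn : Tree.sizeList t using Nat.strong_induction_on generalizing q t with
  | _ n ih =>
    subst hn
    cases q with
    | nil => exact ⟨[], t, rfl, .nil, ht, h⟩
    | cons e q =>
      rcases t with _ | ⟨t, _ | ⟨t', ts⟩⟩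
      · have := h.length_le
        simp at this
      · obtain ⟨t'', ht'', hr⟩ := h.exists_mem (x := .node e.2.1 (e.1 ++ ForestLang.act q s ++ e.2.2))
          (by simp [Step.subst])
        obtain rfl : t'' = t := by simpa using ht''
        cases hr with
        | root a hG =>
          obtain ⟨G', G₃, rfl, hG', hG₃⟩ := hG.split_left
          obtain ⟨G₁, G₂, rfl, hG₁, hG₂⟩ := hG'.split_left
          -- What must embed into `G₂` has at most one root, so a single tree `H₂` suffices; its
          -- siblings `H₁` and `H₃` join the side forests.
          obtain ⟨H₁, H₂, H₃, rfl, hl, hH⟩ := hG₂.split_of_length_le_one (length_act_le_one _ hs)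
          have hsub : [Tree.node e.2.1 (G₁ ++ (H₁ ++ H₂ ++ H₃) ++ G₃)] =
            Step.subst (G₁ ++ H₁, e.2.1, H₃ ++ G₃) H₂ := by simp [Step.subst]
          rw [hsub] at ih ⊢
          obtain ⟨p, t', rfl, hp, hl', ht'⟩ := ih _ (Step.sizeList_subst _ _) hl hH rfl
          refine ⟨_ :: p, t', rfl, .cons ⟨?_, rfl, ?_⟩ hp, hl', ht'⟩
          · simpa using hG₁.append (.nil : FEmb [] H₁)
          · simpa using (.nil : FEmb [] H₃).append hG₃
        | desc a hm hr =>
          rename_i v F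
          obtain ⟨F₁, F₃, rfl⟩ := List.append_of_mem hm
          have hsub : [Tree.node a (F₁ ++ v :: F₃)] = Step.subst (F₁, a, F₃) [v] := by
            simp [Step.subst]
          rw [hsub] at ih ⊢
          obtain ⟨p, t', ht', hp, hl', hst⟩ :=
            ih (q := e :: q) _ (Step.sizeList_subst _ _) (t := [v]) (by simp) (.cons hr .nil) rfl
          refine ⟨(F₁, a, F₃) :: p, t', by simp [ht'], .cons_right hp, hl', hst⟩
      · simp at ht

/-- A tree below `q s` is a context below `q` applied to a tree below `s`, or to a tree below a
side forest of `q`. -/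
theorem FEmb.cofactor {q : List (Step A)} {s t : List (Tree A)} (hs : s.length ≤ 1)
    (h : FEmb t (ForestLang.act q s)) :
    ∃ p t', t = ForestLang.act p t' ∧ t'.length ≤ 1 ∧ CEmb p q ∧
      (FEmb t' s ∨ ∃ e ∈ q, FEmb t' e.1 ∨ FEmb t' e.2.2) := by
  have hl := h.length_le.trans (length_act_le_one q hs)
  induction q generalizing t with
  | nil => exact ⟨[], t, rfl, hl, .nil, .inl h⟩
  | cons e q ih =>
    rcases t with _ | ⟨t, _ | ⟨t', ts⟩⟩
    · exact ⟨[], [], rfl, by simp, .nil, .inl .nil⟩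
    · obtain ⟨t'', ht'', hr⟩ := h.exists_mem (x := t) (by simp)
      obtain rfl : t'' = _ := List.mem_singleton.1 ht''
      cases hr with
      | root a hG =>
        obtain ⟨G', G₃, rfl, hG', hG₃⟩ := hG.split_right
        obtain ⟨G₁, G₂, rfl, hG₁, hG₂⟩ := hG'.split_right
        obtain ⟨p, t', rfl, hl', hp, ht'⟩ := ih hG₂ (hG₂.length_le.trans (length_act_le_one q hs))
        refine ⟨(G₁, e.2.1, G₃) :: p, t', rfl, hl', .cons ⟨hG₁, rfl, hG₃⟩ hp, ?_⟩
        rcases ht' with ht' | ⟨e', he', h⟩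
        · exact .inl ht'
        · exact .inr ⟨e', by simp [he'], h⟩
      | desc a hm hr =>
        -- The tree goes into a child of the root: either a side forest, where the factorization
        -- stops with the empty context, or the part that contains the hole, where the induction
        -- hypothesis applies.
        rcases List.mem_append.1 hm with hm | hm
        · rcases List.mem_append.1 hm with hm | hm
          · exact ⟨[], [t], rfl, by simp, .nil, .inr ⟨e, by simp, .inl (.singleton_of_mem hm hr)⟩⟩
          · obtain ⟨p, t', h₁, hl', hp, ht'⟩ := ih (.singleton_of_mem hm hr) (by simp)
            refine ⟨p, t', h₁, hl', .cons_right hp, ?_⟩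
            rcases ht' with ht' | ⟨e', he', h⟩
            · exact .inl ht'
            · exact .inr ⟨e', by simp [he'], h⟩
        · exact ⟨[], [t], rfl, by simp, .nil, .inr ⟨e, by simp, .inr (.singleton_of_mem hm hr)⟩⟩
    · simp at hl

end ForestLang

/-! ### Noetherian induction on downward closed sets -/

/-- In a strictly descending chain of downward closed sets, pick `x n` in the `n`th set but not in
the next. A pair `x m ≤ x n` with `m < n` would put `x m` into the set with index `m + 1`. -/
theorem WellQuasiOrdered.downClosed_induction {α : Type*} {r : α → α → Prop} [IsPreorder α r]
    (h : WellQuasiOrdered r) {P : Set α → Prop}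
    (ih : ∀ D : Set α, (∀ s t, r s t → t ∈ D → s ∈ D) →
      (∀ D' : Set α, (∀ s t, r s t → t ∈ D' → s ∈ D') → D' ⊂ D → P D') → P D)
    (D : Set α) (hD : ∀ s t, r s t → t ∈ D → s ∈ D) : P D := by
  have wf : WellFounded (fun D D' : {D : Set α // ∀ s t, r s t → t ∈ D → s ∈ D} => D.1 ⊂ D'.1) := by
    rw [wellFounded_iff_isEmpty_descending_chain]
    refine ⟨fun ⟨f, hf⟩ => ?_⟩
    have hanti : ∀ m n, m ≤ n → (f n).1 ⊆ (f m).1 := fun m n hmn => by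
      induction hmn with
      | refl => exact subset_rfl
      | step _ ih => exact (hf _).1.trans ih
    choose x hx hx' using fun n => Set.exists_of_ssubset (hf n)
    obtain ⟨m, n, hmn, hr⟩ := h x
    exact hx' m ((f (m + 1)).2 _ _ hr (hanti (m + 1) n hmn (hx n)))
  exact wf.induction (C := fun D => P D.1) ⟨D, hD⟩
    fun D hD => ih D.1 D.2 fun D' hD' hlt => hD ⟨D', hD'⟩ hlt

/-! ### Zeros of finite monoids that satisfy the identities of piecewise testability -/

/-- The `k`-fold concatenation of a list with itself. -/
def List.power {X : Type*} (k : ℕ) (p : List X) : List X := (List.replicate k p).flatten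

namespace List.power

variable {X : Type*}

@[simp] theorem zero (p : List X) : power 0 p = [] := rfl

@[simp] theorem succ (k : ℕ) (p : List X) : power (k + 1) p = p ++ power k p := by
  simp [power, List.replicate_succ]

theorem add (k m : ℕ) (p : List X) : power (k + m) p = power k p ++ power m p := by
  rw [power, power, power, ← List.replicate_append_replicate, List.flatten_append]

end List.power

open List (power SublistForall₂)

/-- The word `u` is a high power of the product of representatives of all classes met in `S`, so it
absorbs each of them. For a product of `N` factors above `u`, the pigeonhole principle on prefixes
gives `P ~ P W` with `u ≤ W`. A power of `W` absorbs `u` and is absorbed by it, so it is congruent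
to `u`; hence `P ~ P u ~ u`, and the whole product collapses. -/
theorem List.exists_zero {X F : Type*} [Finite F] {R : X → X → Prop} [IsPreorder X R]
    {C : List X → List X → Prop} (hC : Equivalence C)
    (happ : ∀ x y a b, C a b → C (x ++ a ++ y) (x ++ b ++ y))
    (α : List X → F) (hα : ∀ a b, α a = α b → C a b)
    {S : Set (List X)} (hnil : [] ∈ S) (hS : ∀ a ∈ S, ∀ b ∈ S, a ++ b ∈ S)
    (hid : ∀ p, ∃ k, ∀ q, SublistForall₂ R q p →
      C (power k p ++ q) (power k p) ∧ C (q ++ power k p) (power k p)) :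
    ∃ u ∈ S, (∀ q ∈ S, C (u ++ q) u ∧ C (q ++ u) u) ∧
      ∃ N, ∀ l : List (List X), l.length = N → (∀ q ∈ l, q ∈ S ∧ SublistForall₂ R u q) →
        C l.flatten u := by
  classical
  have hright : ∀ y a b, C a b → C (a ++ y) (b ++ y) := fun y a b h => by
    simpa using happ [] y a b h
  have hleft : ∀ x a b, C a b → C (x ++ a) (x ++ b) := fun x a b h => by
    simpa using happ x [] a b h
  have hflat : ∀ l : List (List X), (∀ q ∈ l, q ∈ S) → l.flatten ∈ S := fun l hl => by
    induction l with
    | nil => exact hnil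
    | cons a l ih => exact hS _ (hl a (by simp)) _ (ih fun q hq => hl q (by simp [hq]))
  have hpow : ∀ k, ∀ p ∈ S, power k p ∈ S := fun k p hp =>
    hflat _ fun q hq => by rw [List.eq_of_mem_replicate hq]; exact hp
  have hmem : ∀ (l : List (List X)) (q : List X), q ∈ l → SublistForall₂ R q l.flatten :=
    fun l q hq => by
      obtain ⟨l₁, l₂, rfl⟩ := List.append_of_mem hq
      have h1 : SublistForall₂ R ([] ++ (q ++ [])) (l₁.flatten ++ (q ++ l₂.flatten)) :=
        SublistForall₂.nil.append ((refl_of (SublistForall₂ R) q).append .nil)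
      simpa using h1
  obtain ⟨reps, hreps, hreps'⟩ : ∃ reps : List (List X), (∀ q ∈ reps, q ∈ S) ∧
      ∀ q ∈ S, ∃ r ∈ reps, α r = α q := by
    have hfin : (α '' S).Finite := Set.toFinite _
    obtain ⟨T, hT, hTfin⟩ := (Set.exists_subset_image_finite_and
      (p := fun Y => Y = α '' S) (f := α) (s := S)).1 ⟨α '' S, subset_rfl, hfin, rfl⟩
    refine ⟨hTfin.1.toFinset.toList, fun q hq => hT (by simpa using hq), fun q hq => ?_⟩
    obtain ⟨r, hr, hrq⟩ : α q ∈ α '' T := hTfin.2 ▸ Set.mem_image_of_mem α hq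
    exact ⟨r, by simpa using hr, hrq⟩
  obtain ⟨k, hk⟩ := hid reps.flatten
  have huS : power k reps.flatten ∈ S := hpow _ _ (hflat _ hreps)
  have hz : ∀ q ∈ S, C (power k reps.flatten ++ q) (power k reps.flatten) ∧
      C (q ++ power k reps.flatten) (power k reps.flatten) := fun q hq => by
    obtain ⟨r, hr, hrq⟩ := hreps' q hq
    obtain ⟨h1, h2⟩ := hk r (hmem _ _ hr)
    exact ⟨hC.trans (hleft _ _ _ (hα _ _ hrq.symm)) h1,
      hC.trans (hright _ _ _ (hα _ _ hrq.symm)) h2⟩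
  generalize power k reps.flatten = u at huS hz
  refine ⟨u, huS, hz, Nat.card F, fun l hl hlS => ?_⟩
  obtain ⟨i, j, hij, hαij⟩ : ∃ i j, i < j ∧ j ≤ Nat.card F ∧
      α (l.take i).flatten = α (l.take j).flatten := by
    have : Fintype F := Fintype.ofFinite F
    have hcard : Fintype.card F < Fintype.card (Fin (Nat.card F + 1)) := by
      simp [Nat.card_eq_fintype_card]
    obtain ⟨i, j, hne, heq⟩ := Fintype.exists_ne_map_eq_of_card_lt
      (fun i : Fin (Nat.card F + 1) => α (l.take i).flatten) hcard
    rcases lt_or_gt_of_ne hne with h | h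
    · exact ⟨i, j, h, Nat.lt_succ_iff.1 j.2, heq⟩
    · exact ⟨j, i, h, Nat.lt_succ_iff.1 i.2, heq.symm⟩
  obtain ⟨hj, hαij⟩ := hαij
  set W := ((l.take j).drop i).flatten with hW
  have hsub : ∀ q ∈ (l.take j).drop i, q ∈ l := fun q hq =>
    List.mem_of_mem_take (List.mem_of_mem_drop hq)
  have hWS : W ∈ S := hflat _ fun q hq => (hlS q (hsub q hq)).1
  have huW : SublistForall₂ R u W := by
    have hne : (l.take j).drop i ≠ [] := by
      intro h
      have := congrArg List.length h
      simp at this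
      omega
    obtain ⟨q, hq⟩ := List.exists_mem_of_ne_nil _ hne
    exact trans_of (SublistForall₂ R) (hlS q (hsub q hq)).2 (hmem _ _ hq)
  have hPj : (l.take j).flatten = (l.take i).flatten ++ W := by
    rw [hW, ← List.flatten_append]
    congr 1
    conv_lhs => rw [← List.take_append_drop i (l.take j)]
    rw [List.take_take, min_eq_left hij.le]
  set P := (l.take i).flatten with hP
  have hPS : P ∈ S := hflat _ fun q hq => (hlS q (List.mem_of_mem_take hq)).1
  have hPW : C P (P ++ W) := hα _ _ (hαij.trans (by rw [hPj]))
  obtain ⟨m, hm⟩ := hid W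
  have hPm : ∀ m, C P (P ++ power m W) := fun m => by
    induction m with
    | zero => simpa using hC.refl P
    | succ m ih =>
      rw [power.succ, ← List.append_assoc]
      exact hC.trans ih (hright _ _ _ hPW)
  have hWu : C (power m W) u :=
    hC.trans (hC.symm (hm u huW).1) (hz _ (hpow _ _ hWS)).2
  have hPu : C P u := hC.trans (hC.trans (hPm m) (hleft _ _ _ hWu)) (hz _ hPS).2
  have hl' : l.flatten = P ++ (l.drop i).flatten := by
    rw [hP, ← List.flatten_append, List.take_append_drop]
  rw [hl']
  refine hC.trans (hright _ _ _ hPu) (hz _ (hflat _ fun q hq => ?_)).1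
  exact (hlS q (List.mem_of_mem_drop hq)).1

namespace ForestLang

variable {A : Type*}

/-! ### Alternation along chains -/

/-- `Alternates C D n t` means that some increasing chain in `D` that starts at `t` leaves its
`C`-class `n` times. -/
inductive Alternates (C : List (Tree A) → List (Tree A) → Prop) (D : Set (List (Tree A))) :
    ℕ → List (Tree A) → Prop
  | zero {t} : t ∈ D → Alternates C D 0 t
  | weak {n t t'} : t ∈ D → FEmb t t' → Alternates C D n t' → Alternates C D n t
  | step {n t t'} : t ∈ D → FEmb t t' → ¬ C t t' → Alternates C D n t' → Alternates C D (n + 1) t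

/-- The number of changes of `C`-class along increasing chains in `D` is bounded. -/
def BoundedAlternation (C : List (Tree A) → List (Tree A) → Prop) (D : Set (List (Tree A))) :
    Prop := ∃ K, ∀ n t, Alternates C D n t → n ≤ K

/-- Downward closed sets of forests. -/
def DownClosed (D : Set (List (Tree A))) : Prop := ∀ s t, FEmb s t → t ∈ D → s ∈ D

variable {C : List (Tree A) → List (Tree A) → Prop} {D D₁ D₂ : Set (List (Tree A))}

theorem Alternates.mem {n : ℕ} {t : List (Tree A)} (h : Alternates C D n t) : t ∈ D := by
  cases h <;> assumption

theorem BoundedAlternation.of_constant (h : ∀ t ∈ D, ∀ t' ∈ D, FEmb t t' → C t t') :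
    BoundedAlternation C D := by
  refine ⟨0, fun n t ht => ?_⟩
  induction ht with
  | zero _ => rfl
  | weak _ _ _ ih => exact ih
  | step ht hle hne h' _ => exact absurd (h _ ht _ h'.mem hle) hne

/-- A monotone map whose values detect changes of class sends chains to chains without losing
changes. -/
theorem BoundedAlternation.comap (g : List (Tree A) → List (Tree A))
    (h : BoundedAlternation C D₁) (hg : ∀ t ∈ D, g t ∈ D₁)
    (hle : ∀ t ∈ D, ∀ t' ∈ D, FEmb t t' → FEmb (g t) (g t') ∧ (C (g t) (g t') → C t t')) :
    BoundedAlternation C D := by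
  obtain ⟨K, hK⟩ := h
  refine ⟨K, fun n t ht => hK n (g t) ?_⟩
  induction ht with
  | zero ht => exact .zero (hg _ ht)
  | weak ht h h' ih => exact .weak (hg _ ht) (hle _ ht _ h'.mem h).1 ih
  | step ht h hne h' ih =>
    obtain ⟨h1, h2⟩ := hle _ ht _ h'.mem h
    exact .step (hg _ ht) h1 (fun hc => hne (h2 hc)) ih

theorem BoundedAlternation.mono (h : BoundedAlternation C D₁) (hD : D ⊆ D₁) :
    BoundedAlternation C D :=
  h.comap id (fun _ ht => hD ht) fun _ _ _ _ h => ⟨h, id⟩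

/-- A chain that enters `D₂` stays there, so it is a chain in `D₁` followed by one in `D₂`, with at
most one more change at the crossing. -/
theorem BoundedAlternation.split (h₁ : BoundedAlternation C D₁) (h₂ : BoundedAlternation C D₂)
    (hD : ∀ t ∈ D, t ∈ D₁ ∨ t ∈ D₂) (hup : ∀ t ∈ D₂, ∀ t' ∈ D, FEmb t t' → t' ∈ D₂) :
    BoundedAlternation C D := by
  obtain ⟨K₁, hK₁⟩ := h₁
  obtain ⟨K₂, hK₂⟩ := h₂
  have key₂ : ∀ n t, Alternates C D n t → t ∈ D₂ → n ≤ K₂ := fun n t ht ht₂ => by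
    refine hK₂ n t ?_
    induction ht with
    | zero _ => exact .zero ht₂
    | weak _ h h' ih => exact .weak ht₂ h (ih (hup _ ht₂ _ h'.mem h))
    | step _ h hne h' ih => exact .step ht₂ h hne (ih (hup _ ht₂ _ h'.mem h))
  have key : ∀ n t, Alternates C D n t → t ∈ D₁ → ∃ i, Alternates C D₁ i t ∧ n ≤ i + K₂ + 1 :=
    fun n t ht ht₁ => by
      induction ht with
      | zero _ => exact ⟨0, .zero ht₁, by omega⟩
      | weak _ h h' ih =>
        rcases hD _ h'.mem with h₁ | h₂
        · obtain ⟨i, hi, hn⟩ := ih h₁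
          exact ⟨i, .weak ht₁ h hi, hn⟩
        · exact ⟨0, .zero ht₁, by have := key₂ _ _ h' h₂; omega⟩
      | step _ h hne h' ih =>
        rcases hD _ h'.mem with h₁ | h₂
        · obtain ⟨i, hi, hn⟩ := ih h₁
          exact ⟨i + 1, .step ht₁ h hne hi, by omega⟩
        · exact ⟨0, .zero ht₁, by have := key₂ _ _ h' h₂; omega⟩
  refine ⟨K₁ + K₂ + 1, fun n t ht => ?_⟩
  rcases hD t ht.mem with h | h
  · obtain ⟨i, hi, hn⟩ := key n t ht h
    have := hK₁ i t hi
    omega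
  · have := key₂ n t ht h
    omega

/-- A finite chain lies wholly in whichever downward closed set contains its top. -/
theorem BoundedAlternation.union (h₁ : BoundedAlternation C D₁) (h₂ : BoundedAlternation C D₂)
    (hD₁ : DownClosed D₁) (hD₂ : DownClosed D₂) (hD : ∀ t ∈ D, t ∈ D₁ ∨ t ∈ D₂) :
    BoundedAlternation C D := by
  obtain ⟨K₁, hK₁⟩ := h₁
  obtain ⟨K₂, hK₂⟩ := h₂
  have key : ∀ n t, Alternates C D n t → Alternates C D₁ n t ∨ Alternates C D₂ n t :=
    fun n t ht => by
      induction ht with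
      | zero ht => exact (hD _ ht).imp .zero .zero
      | weak _ h _ ih =>
        exact ih.imp (fun h' => .weak (hD₁ _ _ h h'.mem) h h')
          (fun h' => .weak (hD₂ _ _ h h'.mem) h h')
      | step _ h hne _ ih =>
        exact ih.imp (fun h' => .step (hD₁ _ _ h h'.mem) h hne h')
          (fun h' => .step (hD₂ _ _ h h'.mem) h hne h')
  refine ⟨K₁ + K₂, fun n t ht => ?_⟩
  rcases key n t ht with h | h
  · exact (hK₁ n t h).trans (by omega)
  · exact (hK₂ n t h).trans (by omega)

/-- A factorization of the top of a chain induces factorizations of everything below it. Each change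
of class then changes the class of a factor. -/
theorem BoundedAlternation.append (h₁ : BoundedAlternation C D₁) (h₂ : BoundedAlternation C D₂)
    (happ : ∀ a a' b b', C a a' → C b b' → C (a ++ b) (a' ++ b'))
    (hD₁ : DownClosed D₁) (hD₂ : DownClosed D₂)
    (hD : ∀ t ∈ D, ∃ a ∈ D₁, ∃ b ∈ D₂, t = a ++ b) : BoundedAlternation C D := by
  obtain ⟨K₁, hK₁⟩ := h₁
  obtain ⟨K₂, hK₂⟩ := h₂
  have key : ∀ n t, Alternates C D n t → ∃ i j a b, t = a ++ b ∧ Alternates C D₁ i a ∧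
      Alternates C D₂ j b ∧ n ≤ i + j := fun n t ht => by
    induction ht with
    | zero ht =>
      obtain ⟨a, ha, b, hb, rfl⟩ := hD _ ht
      exact ⟨0, 0, a, b, rfl, .zero ha, .zero hb, by simp⟩
    | weak _ h _ ih =>
      obtain ⟨i, j, a, b, rfl, ha, hb, hn⟩ := ih
      obtain ⟨a', b', rfl, ha', hb'⟩ := h.split_right
      exact ⟨i, j, a', b', rfl, .weak (hD₁ _ _ ha' ha.mem) ha' ha,
        .weak (hD₂ _ _ hb' hb.mem) hb' hb, hn⟩
    | step _ h hne _ ih =>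
      obtain ⟨i, j, a, b, rfl, ha, hb, hn⟩ := ih
      obtain ⟨a', b', rfl, ha', hb'⟩ := h.split_right
      by_cases hc : C a' a
      · have hc' : ¬ C b' b := fun hc' => hne (happ _ _ _ _ hc hc')
        exact ⟨i, j + 1, a', b', rfl, .weak (hD₁ _ _ ha' ha.mem) ha' ha,
          .step (hD₂ _ _ hb' hb.mem) hb' hc' hb, by omega⟩
      · exact ⟨i + 1, j, a', b', rfl, .step (hD₁ _ _ ha' ha.mem) ha' hc ha,
          .weak (hD₂ _ _ hb' hb.mem) hb' hb, by omega⟩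
  refine ⟨K₁ + K₂, fun n t ht => ?_⟩
  obtain ⟨i, j, a, b, -, ha, hb, hn⟩ := key n t ht
  have := hK₁ i a ha
  have := hK₂ j b hb
  omega

theorem DownClosed.not_above (hD : DownClosed D) (x : List (Tree A)) :
    DownClosed {t ∈ D | ¬ FEmb x t} :=
  fun _ _ h ht => ⟨hD _ _ h ht.1, fun h' => ht.2 (h'.trans h)⟩

/-- Bounded alternation amounts to being determined by finitely many pieces. -/
theorem BoundedAlternation.exists_size [Finite A] (hC : Equivalence C)
    (h : BoundedAlternation C Set.univ) :
    ∃ N, ∀ t t' : List (Tree A),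
      (∀ s, Tree.sizeList s ≤ N → (FEmb s t ↔ FEmb s t')) → C t t' := by
  classical
  obtain ⟨K, hK⟩ := h
  -- The level of a forest is the greatest number of changes on a chain starting there. `B n` is a
  -- basis of the upward closed set of forests of level less than `n`.
  choose B hB hB' using fun n =>
    (FEmb.wellQuasiOrdered (A := A)).exists_finset_basis {t | ¬ Alternates C Set.univ n t}
  refine ⟨((Finset.range (K + 2)).biUnion B).sup Tree.sizeList, fun t t' htt' => ?_⟩
  have hex : ∀ t, ∃ n, ¬ Alternates C Set.univ n t :=
    fun t => ⟨K + 1, fun h => absurd (hK _ _ h) (by omega)⟩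
  have hup : ∀ n s t, FEmb s t → ¬ Alternates C Set.univ n s → ¬ Alternates C Set.univ n t :=
    fun n s t hst hs ht => hs (.weak trivial hst ht)
  have hfind : ∀ t, ∃ n s, n ≤ K ∧ FEmb s t ∧ s ∈ B (n + 1) ∧ Alternates C Set.univ n t ∧
      ¬ Alternates C Set.univ (n + 1) s := fun t => by
    have hspec := Nat.find_spec (hex t)
    have hmin := fun m => Nat.find_min (hex t) (m := m)
    obtain ⟨n, hn⟩ : ∃ n, Nat.find (hex t) = n + 1 := Nat.exists_eq_succ_of_ne_zero
      (fun h0 => by rw [h0] at hspec; exact hspec (.zero trivial))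
    rw [hn] at hspec hmin
    obtain ⟨s, hs, hst⟩ := hB' (n + 1) t hspec
    have hnt := not_not.1 (hmin n (by omega))
    exact ⟨n, s, hK _ _ hnt, hst, hs, hnt, hB _ _ hs⟩
  have hsz : ∀ n, n ≤ K → ∀ s ∈ B (n + 1),
      Tree.sizeList s ≤ ((Finset.range (K + 2)).biUnion B).sup Tree.sizeList :=
    fun n hn s hs => Finset.le_sup (f := Tree.sizeList)
      (Finset.mem_biUnion.2 ⟨n + 1, Finset.mem_range.2 (by omega), hs⟩)
  have hle : ∀ m n, m ≤ n → ∀ t, Alternates C Set.univ n t → Alternates C Set.univ m t :=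
    fun m n hmn t ht => by
      induction ht generalizing m with
      | zero ht => obtain rfl : m = 0 := by omega
                   exact .zero ht
      | weak ht h _ ih => exact .weak ht h (ih m hmn)
      | step ht h hne _ ih =>
        cases m with
        | zero => exact .zero ht
        | succ m => exact .step ht h hne (ih m (by omega))
  obtain ⟨n, s, hn, hst, hs, hnt, hns⟩ := hfind t
  obtain ⟨n', s', hn', hst', hs', hnt', hns'⟩ := hfind t'
  have hst₂ : FEmb s t' := (htt' s (hsz n hn s hs)).1 hst
  have hst'₂ : FEmb s' t := (htt' s' (hsz n' hn' s' hs')).2 hst'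
  have h1 : n' ≤ n := by
    by_contra hlt
    exact hup _ _ _ hst₂ hns (hle _ _ (by omega) _ hnt')
  have h2 : n ≤ n' := by
    by_contra hlt
    exact hup _ _ _ hst'₂ hns' (hle _ _ (by omega) _ hnt)
  obtain rfl : n = n' := le_antisymm h2 h1
  -- A basis element `s` below `t` has level at most `n`. If its class differed from that of `t`,
  -- which has level `n`, it would start a chain with `n + 1` changes.
  have hc : ∀ t, FEmb s t → Alternates C Set.univ n t → C s t := fun t hst ht => by
    by_contra hne
    exact hns (.step trivial hst hne ht)
  exact hC.trans (hC.symm (hc t hst hnt)) (hc t' hst₂ hnt')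

end ForestLang

theorem List.SublistForall₂.exists_of_power {X : Type*} {R : X → X → Prop} {u t : List X} {N : ℕ}
    (h : SublistForall₂ R (power N u) t) :
    ∃ (l : List (List X)) (r : List X), l.length = N ∧ t = l.flatten ++ r ∧
      ∀ q ∈ l, SublistForall₂ R u q := by
  induction N generalizing t with
  | zero => exact ⟨[], t, rfl, rfl, by simp⟩
  | succ N ih =>
    rw [power.succ] at h
    obtain ⟨t₁, t₂, rfl, h₁, h₂⟩ := h.split_left
    obtain ⟨l, r, rfl, rfl, hl⟩ := ih h₂
    exact ⟨t₁ :: l, r, rfl, by simp, by simpa using ⟨h₁, hl⟩⟩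

-- Bounded alternation for congruences that satisfy the identities.

namespace ForestLang

variable {A : Type*} {C : List (Tree A) → List (Tree A) → Prop} {D : Set (List (Tree A))}

theorem FEmb.factor_power {u : List (Step A)} {N : ℕ} {s t : List (Tree A)} (hs : s.length ≤ 1)
    (ht : t.length ≤ 1) (h : FEmb (ForestLang.act (power N u) s) t) :
    ∃ (l : List (List (Step A))) (t' : List (Tree A)), l.length = N ∧
      t = ForestLang.act l.flatten t' ∧ (∀ q ∈ l, CEmb u q) ∧ t'.length ≤ 1 ∧ FEmb s t' := by
  induction N generalizing t with
  | zero => exact ⟨[], t, rfl, rfl, by simp, ht, h⟩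
  | succ N ih =>
    rw [power.succ, act_append] at h
    obtain ⟨p, t', rfl, hp, hl, hst⟩ := h.factor (length_act_le_one _ hs) ht
    obtain ⟨l, t'', rfl, rfl, hl', h'⟩ := ih hl hst
    exact ⟨p :: l, t'', rfl, by simp [act_append], by simpa using ⟨hp, hl'⟩, h'⟩

/-- A congruence of finite index on forests that satisfies the identities of cca-piecewise
testability. -/
structure PiecewiseCongruence (C : List (Tree A) → List (Tree A) → Prop) : Prop where
  equiv : Equivalence C
  append : ∀ a a' b b', C a a' → C b b' → C (a ++ b) (a' ++ b')
  node : ∀ a s t, C s t → C [.node a s] [.node a t]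
  finite_forest : ∃ (n : ℕ) (α : List (Tree A) → Fin n), ∀ s t, α s = α t → C s t
  finite_context : ∃ (n : ℕ) (α : List (Step A) → Fin n), ∀ p q, α p = α q →
    ∀ s : List (Tree A), s.length ≤ 1 → C (act p s) (act q s)
  forest_identity : ∀ p, ∃ k, ∀ q, FEmb q p →
    C (power k p ++ q) (power k p) ∧ C (q ++ power k p) (power k p)
  context_identity : ∀ p, ∃ k, ∀ q, CEmb q p → ∀ s : List (Tree A), s.length ≤ 1 →
    C (act (power k p ++ q) s) (act (power k p) s) ∧
      C (act (q ++ power k p) s) (act (power k p) s)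

namespace PiecewiseCongruence

theorem act (h : PiecewiseCongruence C) (q : List (Step A)) {s t : List (Tree A)} (hst : C s t) :
    C (ForestLang.act q s) (ForestLang.act q t) := by
  induction q with
  | nil => exact hst
  | cons e q ih =>
    exact h.node _ _ _ (h.append _ _ _ _ (h.append _ _ _ _ (h.equiv.refl _) ih) (h.equiv.refl _))

/-- Downward closed sets that are closed under concatenation. -/
theorem bounded_of_append_closed (h : PiecewiseCongruence C) (hD : DownClosed D)
    (hne : D.Nonempty) (happ : ∀ x ∈ D, ∀ y ∈ D, x ++ y ∈ D)
    (ih : ∀ x ∈ D, BoundedAlternation C {t ∈ D | ¬ FEmb x t}) : BoundedAlternation C D := by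
  obtain ⟨n, α, hα⟩ := h.finite_forest
  have hnil : [] ∈ D := hne.elim fun t ht => hD _ _ .nil ht
  obtain ⟨u, hu, hz, N, hN⟩ := List.exists_zero (R := Tree.Emb) h.equiv
    (fun x y a b hab => h.append _ _ _ _ (h.append _ _ _ _ (h.equiv.refl _) hab) (h.equiv.refl _))
    α hα hnil happ h.forest_identity
  have huN : power N u ∈ D := by
    clear hN
    induction N with
    | zero => exact hnil
    | succ N ih => rw [power.succ]; exact happ _ hu _ ih
  -- Everything in `D` above `N` copies of the zero `u` is congruent to `u`; the rest of `D` falls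
  -- under the induction hypothesis.
  refine (ih _ huN).split (D₂ := {t ∈ D | FEmb (power N u) t}) (.of_constant ?_)
    (fun t ht => by by_cases h : FEmb (power N u) t <;> simp [ht, h])
    (fun t ht t' ht' hle => ⟨ht', ht.2.trans hle⟩)
  have key : ∀ t ∈ D, FEmb (power N u) t → C t u := fun t ht hut => by
    obtain ⟨l, r, hl, rfl, hq⟩ := hut.exists_of_power
    have hr : r ∈ D := hD _ _ (by simpa using FEmb.surround (l := l.flatten) (r := []) (.refl r)) ht
    refine h.equiv.trans (h.append _ _ _ _ (hN l hl fun q hql => ⟨?_, hq q hql⟩) (h.equiv.refl r))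
      (hz r hr).1
    obtain ⟨l₁, l₂, rfl⟩ := List.append_of_mem hql
    refine hD _ _ ?_ ht
    simpa using FEmb.surround (l := l₁.flatten) (r := l₂.flatten ++ r) (.refl q)
  exact fun t ht t' ht' _ => h.equiv.trans (key t ht.1 ht.2) (h.equiv.symm (key t' ht'.1 ht'.2))

/-- Directed downward closed sets of trees. -/
theorem bounded_of_trees [Finite A] (h : PiecewiseCongruence C) (hD : DownClosed D)
    (hlen : ∀ t ∈ D, t.length ≤ 1)
    (hdir : ∀ x ∈ D, ∀ y ∈ D, ∃ z ∈ D, FEmb x z ∧ FEmb y z)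
    (ih : ∀ x ∈ D, BoundedAlternation C {t ∈ D | ¬ FEmb x t})
    (ih' : ∀ x, [x] ∈ D → BoundedAlternation C {F | ∀ y ∈ F, [y] ∈ D ∧ ¬ FEmb [x] [y]}) :
    BoundedAlternation C D := by
  classical
  by_cases hx₀ : ∃ x, [x] ∈ D
  swap
  · refine .of_constant fun t ht t' ht' _ => ?_
    have hnil : ∀ t ∈ D, t = [] := fun t ht => by
      rcases t with _ | ⟨x, _ | ⟨y, t⟩⟩
      · rfl
      · exact absurd ⟨x, ht⟩ hx₀
      · simpa using hlen _ ht
    rw [hnil t ht, hnil t' ht']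
    exact h.equiv.refl _
  obtain ⟨x₀, hx₀⟩ := hx₀
  -- The elementary contexts that preserve `D`; their compositions form the monoid `S` acting on
  -- `D`.
  let P : Set (Step A) := {e | ∀ s ∈ D, e.subst s ∈ D}
  have hP : ∀ e ∈ P, ∀ s ∈ D, e.subst s ∈ D := fun e he => he
  have hPdown : ∀ e e', Step.Emb e e' → e' ∈ P → e ∈ P := fun e e' hee he' s hs =>
    hD _ _ (hee.subst (.refl s)) (he' s hs)
  -- By directedness one tree `x` dominates failure witnesses for a finite basis of the complement
  -- of `P`; hence `x` alone tests membership in `P`.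
  obtain ⟨x, hxD, hxP⟩ : ∃ x, [x] ∈ D ∧ ∀ e : Step A, e.subst [x] ∈ D → e ∈ P := by
    obtain ⟨B, hB, hB'⟩ := (Step.wellQuasiOrdered (A := A)).exists_finset_basis Pᶜ
    have hBs : ∀ e, ∃ s, e ∈ B → s ∈ D ∧ e.subst s ∉ D := fun e => by
      by_cases he : e ∈ B
      · have := hB e he
        simp only [P, Set.mem_compl_iff, Set.mem_ofPred_eq, not_forall] at this
        obtain ⟨s, hs, hs'⟩ := this
        exact ⟨s, fun _ => ⟨hs, hs'⟩⟩
      · exact ⟨[], fun h => absurd h he⟩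
    choose σ hσ using hBs
    obtain ⟨z, hz, hxz, hσz⟩ : ∃ z ∈ D, FEmb [x₀] z ∧ ∀ e ∈ B, FEmb (σ e) z := by
      have : ∀ B' ⊆ B, ∃ z ∈ D, FEmb [x₀] z ∧ ∀ e ∈ B', FEmb (σ e) z := fun B' => by
        induction B' using Finset.induction_on with
        | empty => exact fun _ => ⟨_, hx₀, .refl _, by simp⟩
        | insert e B' _ ih =>
          intro hsub
          obtain ⟨z, hz, hxz, hσz⟩ := ih fun e he => hsub (Finset.mem_insert_of_mem he)
          obtain ⟨z', hz', h₁, h₂⟩ := hdir z hz _ (hσ e (hsub (Finset.mem_insert_self _ _))).1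
          refine ⟨z', hz', hxz.trans h₁, fun e' he' => ?_⟩
          rcases Finset.mem_insert.1 he' with rfl | he'
          · exact h₂
          · exact (hσz e' he').trans h₁
      exact this B subset_rfl
    obtain ⟨x, rfl⟩ : ∃ x, z = [x] := List.length_eq_one_iff.1
      (le_antisymm (hlen z hz) (by simpa using hxz.length_le))
    refine ⟨x, hz, fun e he => by_contra fun heP => ?_⟩
    obtain ⟨e', he', hee⟩ := hB' e heP
    exact (hσ e' he').2 (hD _ _ (hee.subst (hσz e' he')) he)
  have hxP' : ∀ (r : List (Step A)) (t : List (Tree A)), ForestLang.act r t ∈ D → t.length ≤ 1 →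
      FEmb [x] t → ∀ e ∈ r, e ∈ P := fun r t hrt ht hxt e he => by
    obtain ⟨r₁, r₂, rfl⟩ := List.append_of_mem he
    refine hxP e (hD _ _ ?_ hrt)
    rw [act_append, act_cons]
    have h1 : FEmb (e.subst [x]) (e.subst (ForestLang.act r₂ t)) :=
      (refl_of Step.Emb e).subst ((CEmb.act (p := []) .nil (by simp) hxt))
    exact h1.trans (CEmb.act (p := []) .nil (by simp) (.refl _))
  let S : Set (List (Step A)) := {q | ∀ e ∈ q, e ∈ P}
  have hSapp : ∀ p ∈ S, ∀ q ∈ S, p ++ q ∈ S := fun p hp q hq e he =>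
    (List.mem_append.1 he).elim (hp e) (hq e)
  have hSD : ∀ q ∈ S, ∀ s ∈ D, ForestLang.act q s ∈ D := fun q hq s hs => by
    induction q with
    | nil => exact hs
    | cons e q ih =>
      exact hP e (hq e (by simp)) _ (ih fun e' he' => hq e' (by simp [he']))
  obtain ⟨n, α, hα⟩ := h.finite_context
  obtain ⟨u, hu, hz, N, hN⟩ := List.exists_zero (R := Step.Emb) (S := S)
    (C := fun p q => ∀ s : List (Tree A), s.length ≤ 1 →
      C (ForestLang.act p s) (ForestLang.act q s))
    ⟨fun _ _ _ => h.equiv.refl _, fun h' s hs => h.equiv.symm (h' s hs),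
      fun h₁ h₂ s hs => h.equiv.trans (h₁ s hs) (h₂ s hs)⟩
    (fun x y a b hab s hs => by
      simp only [act_append]
      exact h.act _ (hab _ (length_act_le_one _ hs)))
    α hα (by simp [S]) hSapp
    (fun p => (h.context_identity p).imp fun k hk q hq =>
      ⟨fun s hs => (hk q hq s hs).1, fun s hs => (hk q hq s hs).2⟩)
  -- Write `f s` for the class of `u s`. It does not change when a context of `S` is put around `s`.
  have hf : ∀ q ∈ S, ∀ s : List (Tree A), s.length ≤ 1 →
      C (ForestLang.act u (ForestLang.act q s)) (ForestLang.act u s) := fun q hq s hs => by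
    rw [← act_append]; exact (hz q hq).1 s hs
  -- A context with `s` in a side forest, applied to the empty forest, is the same tree as a bare
  -- letter context applied to `s`. Invariance of `f` then gives `f s = f []`.
  have hside : ∀ e ∈ P, ∀ s : List (Tree A), s.length ≤ 1 → FEmb s e.1 ∨ FEmb s e.2.2 →
      C (ForestLang.act u s) (ForestLang.act u []) := fun e he s hs hse => by
    obtain ⟨e', he', hee'⟩ : ∃ e' ∈ P, Step.subst e' [] = Step.subst ([], e.2.1, []) s := by
      rcases hse with hse | hse
      · exact ⟨(s, e.2.1, []), hPdown _ e ⟨hse, rfl, .nil⟩ he, by simp [Step.subst]⟩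
      · exact ⟨([], e.2.1, s), hPdown _ e ⟨.nil, rfl, hse⟩ he, by simp [Step.subst]⟩
    have h₀ : ([], e.2.1, []) ∈ P := hPdown _ e ⟨.nil, rfl, .nil⟩ he
    have h1 := hf [([], e.2.1, [])] (List.forall_mem_singleton.2 h₀) s hs
    have h2 := hf [e'] (List.forall_mem_singleton.2 he') [] (by simp)
    simp only [act_cons, act_nil] at h1 h2
    rw [hee'] at h2
    exact h.equiv.trans (h.equiv.symm h1) h2
  let Irr : List (Tree A) → Prop := fun φ => ∀ e ∈ P, ∀ ψ ∈ D, φ ≠ e.subst ψ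
  have hirr : ∀ φ ∈ D, Irr φ → ∀ q ∈ S, ∀ ψ ∈ D, FEmb φ (ForestLang.act q ψ) →
      FEmb φ ψ ∨ ∃ e ∈ P, FEmb φ e.1 ∨ FEmb φ e.2.2 := fun φ hφ hI q hq ψ hψ hle => by
    obtain ⟨p, t, rfl, ht, hp, h'⟩ := hle.cofactor (hlen ψ hψ)
    cases p with
    | nil => exact h'.imp id fun ⟨e, he, h'⟩ => ⟨e, hq e he, h'⟩
    | cons e p =>
      obtain ⟨e', he', hee⟩ := hp.exists_mem (x := e) (by simp)
      exact absurd rfl (hI e (hPdown e e' hee (hq e' he')) (ForestLang.act p t)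
        (hD _ _ (e.emb_subst (length_act_le_one _ ht) (.refl _)) hφ))
  -- Stripping contexts of `P` as long as possible leaves an irreducible core `fin t`, and `f t = f
  -- (fin t)`.
  have hend : ∀ t, ∃ φ, t ∈ D → φ ∈ D ∧ Irr φ ∧ ∃ q ∈ S, t = ForestLang.act q φ := fun t => by
    induction hn : Tree.sizeList t using Nat.strong_induction_on generalizing t with
    | _ n ih =>
      subst hn
      by_cases hI : Irr t
      · exact ⟨t, fun ht => ⟨ht, hI, [], by simp [S], rfl⟩⟩
      · simp only [Irr, not_forall, not_not] at hI
        obtain ⟨e, he, ψ, hψ, rfl⟩ := hI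
        obtain ⟨φ, hφ⟩ := ih _ (e.sizeList_subst ψ) ψ rfl
        obtain ⟨h₁, h₂, q, hq, rfl⟩ := hφ hψ
        exact ⟨φ, fun _ => ⟨h₁, h₂, e :: q, List.forall_mem_cons.2 ⟨he, hq⟩, rfl⟩⟩
  choose fin hfinD hfinI hfin using hend
  have hfin' : ∀ t ∈ D, C (ForestLang.act u t) (ForestLang.act u (fin t)) := fun t ht => by
    obtain ⟨q, hq, h'⟩ := hfin t ht
    conv_lhs => rw [h']
    exact hf q hq _ (hlen _ (hfinD t ht))
  have hbase : ForestLang.act (power N u) [x] ∈ D := by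
    refine hSD _ (fun e he => ?_) _ hxD
    obtain ⟨l, hl, he⟩ := List.mem_flatten.1 he
    rw [List.eq_of_mem_replicate hl] at he
    exact hu e he
  refine (ih _ hbase).split (D₂ := {t ∈ D | FEmb (ForestLang.act (power N u) [x]) t}) ?_
    (fun t ht => by by_cases h : FEmb (ForestLang.act (power N u) [x]) t <;> simp [ht, h])
    (fun t ht t' ht' hle => ⟨ht', ht.2.trans hle⟩)
  set D₂ := {t ∈ D | FEmb (ForestLang.act (power N u) [x]) t} with hD₂
  -- Such a `t` factors through `N` contexts above `u`, all in `S` by the choice of `x`, so their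
  -- product acts like `u`: on `D₂` the class of `t` is `f t`.
  have hD₂f : ∀ t ∈ D₂, C t (ForestLang.act u t) := fun t ht => by
    obtain ⟨l, t', hl, rfl, hlu, hlt, hxt⟩ := ht.2.factor_power (by simp) (hlen t ht.1)
    have hlS : l.flatten ∈ S := hxP' _ t' ht.1 hlt hxt
    refine h.equiv.trans (hN l hl (fun q hq => ⟨fun e he => hlS e ?_, hlu q hq⟩) t' hlt)
      (h.equiv.symm (hf _ hlS t' hlt))
    exact List.mem_flatten.2 ⟨q, hq, he⟩
  -- An upward closed part of `D₂`, on which passing to cores is monotone. Outside it, `f` is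
  -- constantly `f []`.
  let E : Set (List (Tree A)) :=
    {t ∈ D₂ | ∃ t₀ ∈ D₂, FEmb t₀ t ∧ ¬ C (ForestLang.act u t₀) (ForestLang.act u [])}
  refine BoundedAlternation.split
    (D₁ := {t ∈ D₂ | C (ForestLang.act u t) (ForestLang.act u [])}) (D₂ := E)
    (.of_constant fun t ht t' ht' _ => ?_) ?_ (fun t ht => ?_)
    (fun t ht t' ht' hle => ⟨ht', ht.2.imp fun t₀ h₀ => ⟨h₀.1, h₀.2.1.trans hle, h₀.2.2⟩⟩)
  · exact h.equiv.trans (h.equiv.trans (hD₂f t ht.1) ht.2)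
      (h.equiv.symm (h.equiv.trans (hD₂f t' ht'.1) ht'.2))
  · refine BoundedAlternation.comap (D₁ := {φ ∈ D | Irr φ}) fin ?_
      (fun t ht => ⟨hfinD t ht.1.1, hfinI t ht.1.1⟩) (fun t ht t' ht' hle => ⟨?_, fun hc => ?_⟩)
    · refine BoundedAlternation.split ((ih _ hxD).mono (D := {φ ∈ D | Irr φ ∧ ¬ FEmb [x] φ})
        fun φ hφ => ⟨hφ.1, hφ.2.2⟩) (D₂ := {φ ∈ D | Irr φ ∧ FEmb [x] φ}) ?_
        (fun t ht => by by_cases h : FEmb [x] t <;> simp [ht.1, ht.2, h])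
        (fun t ht t' ht' hle => ⟨ht'.1, ht'.2, ht.2.2.trans hle⟩)
      -- If a child of an irreducible `φ` were above `x`, the context around this child would map
      -- `x` into `D`, so it would be in `P` and `φ` would be reducible. Hence the children avoid
      -- `x`, and `ih'` applies to them.
      have hnode : ∀ φ ∈ {φ ∈ D | Irr φ ∧ FEmb [x] φ}, ∃ a F, φ = [Tree.node a F] ∧
          ∀ y ∈ F, [y] ∈ D ∧ ¬ FEmb [x] [y] := fun φ hφ => by
        obtain ⟨⟨a, F⟩, rfl⟩ : ∃ y, φ = [y] := List.length_eq_one_iff.1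
          (le_antisymm (hlen φ hφ.1) (by simpa using hφ.2.2.length_le))
        refine ⟨a, F, rfl, fun y hy => ?_⟩
        obtain ⟨F₁, F₂, rfl⟩ := List.append_of_mem hy
        have heq : [Tree.node a (F₁ ++ y :: F₂)] = Step.subst (F₁, a, F₂) [y] := by
          simp [Step.subst]
        rw [heq] at hφ
        have hy : [y] ∈ D := hD _ _ (Step.emb_subst _ (by simp) (.refl _)) hφ.1
        exact ⟨hy, fun hxy => hφ.2.1 _ (hxP _ (hD _ _ ((refl_of Step.Emb _).subst hxy) hφ.1))
          _ hy rfl⟩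
      refine (ih' x hxD).comap
        (fun φ => φ.flatMap fun t => match t with | .node _ F => F) (fun φ hφ => ?_)
        (fun φ hφ φ' hφ' hle => ?_)
      · obtain ⟨a, F, rfl, hF⟩ := hnode φ hφ
        simpa using hF
      · obtain ⟨a, F, rfl, hF⟩ := hnode φ hφ
        obtain ⟨a', F', rfl, hF'⟩ := hnode φ' hφ'
        simp only [List.flatMap_cons, List.flatMap_nil, List.append_nil]
        obtain ⟨y, hy, hr⟩ := hle.exists_mem (x := .node a F) (by simp)
        obtain rfl := List.mem_singleton.1 hy
        cases hr with
        | root _ hr => exact ⟨hr, fun hc => h.node _ _ _ hc⟩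
        | desc _ hm hr => exact absurd (hφ.2.2.trans (.cons hr .nil)) (hF' _ hm).2
    · obtain ⟨ht, t₀, ht₀, hle₀, hne₀⟩ := ht
      have hne : ∀ e ∈ P, ¬ (FEmb (fin t₀) e.1 ∨ FEmb (fin t₀) e.2.2) := fun e he hs =>
        hne₀ (h.equiv.trans (hfin' t₀ ht₀.1) (hside e he _ (hlen _ (hfinD t₀ ht₀.1)) hs))
      -- An irreducible core that embeds into `t'` embeds into the core of `t'` or into a side
      -- forest of a context of `P`. Below elements of `E` the second case is excluded, as it would
      -- force `f t₀ = f []`.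
      have hmono : ∀ t ∈ D, ∀ t' ∈ D, FEmb t t' →
          (∀ e ∈ P, ¬ (FEmb (fin t) e.1 ∨ FEmb (fin t) e.2.2)) → FEmb (fin t) (fin t') := by
        intro t ht t' ht' hle hns
        obtain ⟨q, hq, h₁⟩ := hfin t ht
        obtain ⟨q', hq', h₂⟩ := hfin t' ht'
        have hft : FEmb (fin t) t := by
          conv_rhs => rw [h₁]
          exact CEmb.act (p := []) .nil (hlen _ (hfinD t ht)) (.refl _)
        have hle' := hft.trans hle
        rw [h₂] at hle'
        rcases hirr _ (hfinD t ht) (hfinI t ht) q' hq' _ (hfinD t' ht') hle' with h' | ⟨e, he, h'⟩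
        · exact h'
        · exact absurd h' (hns e he)
      have h₀ := hmono t₀ ht₀.1 t ht.1 hle₀ hne
      exact hmono t ht.1 t' ht'.1.1 hle fun e he hs =>
        hne e he (hs.imp h₀.trans h₀.trans)
    · have h₁ := h.equiv.trans (hD₂f t ht.1) (hfin' t ht.1.1)
      have h₂ := h.equiv.trans (hD₂f t' ht'.1) (hfin' t' ht'.1.1)
      exact h.equiv.trans h₁ (h.equiv.trans (h.act u hc) (h.equiv.symm h₂))
  · by_cases hc : C (ForestLang.act u t) (ForestLang.act u [])
    · exact .inl ⟨ht, hc⟩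
    · exact .inr ⟨ht, t, ht, .refl t, hc⟩

/-- The outer induction is on the set of trees allowed as roots, the inner one on `D`. A set that is
not directed is a union of two smaller ones. One that contains some forest with several roots and is
not closed under concatenation lies in a concatenation of three smaller ones. The two lemmas above
treat the remaining cases. -/
theorem bounded [Finite A] (h : PiecewiseCongruence C) :
    BoundedAlternation C Set.univ := by
  have outer := (Tree.wellQuasiOrdered (A := A)).downClosed_induction
    (P := fun T => ∀ D : Set (List (Tree A)), DownClosed D → (∀ t ∈ D, ∀ x ∈ t, x ∈ T) →
      BoundedAlternation C D) ?_ Set.univ (fun _ _ _ _ => trivial)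
  · exact outer _ (fun _ _ _ _ => trivial) fun _ _ _ _ => trivial
  intro T _ ihT D hD
  refine (FEmb.wellQuasiOrdered (A := A)).downClosed_induction
    (P := fun D => (∀ t ∈ D, ∀ x ∈ t, x ∈ T) → BoundedAlternation C D) ?_ D hD
  intro D hD ihD hDT
  have ih : ∀ D' : Set (List (Tree A)), DownClosed D' → D' ⊆ D → (∃ x ∈ D, x ∉ D') →
      BoundedAlternation C D' := fun D' hD' hsub ⟨x, hx, hx'⟩ =>
    ihD D' hD' ⟨hsub, fun h => hx' (h hx)⟩ fun t ht => hDT t (hsub ht)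
  have ihx : ∀ x ∈ D, BoundedAlternation C {t ∈ D | ¬ FEmb x t} := fun x hx =>
    ih _ (DownClosed.not_above hD x) (fun t ht => ht.1) ⟨x, hx, fun h => h.2 (.refl x)⟩
  by_cases hdir : ∀ x ∈ D, ∀ y ∈ D, ∃ z ∈ D, FEmb x z ∧ FEmb y z
  swap
  · push Not at hdir
    obtain ⟨x, hx, y, hy, hxy⟩ := hdir
    refine (ihx x hx).union (ihx y hy) (DownClosed.not_above hD x) (DownClosed.not_above hD y)
      fun t ht => ?_
    by_cases hxt : FEmb x t
    · exact .inr ⟨ht, hxy t ht hxt⟩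
    · exact .inl ⟨ht, hxt⟩
  by_cases hlen : ∀ t ∈ D, t.length ≤ 1
  · refine h.bounded_of_trees hD hlen hdir ihx fun x hx => ?_
    refine ihT {y | [y] ∈ D ∧ ¬ FEmb [x] [y]} (fun s t hst ht => ?_) ?_ _ (fun s t hst ht => ?_)
      (fun t ht => ht)
    · have hst' : FEmb [s] [t] := .cons hst .nil
      exact ⟨hD _ _ hst' ht.1, fun h' => ht.2 (h'.trans hst')⟩
    · exact ⟨fun y hy => hDT _ hy.1 y (by simp), fun hsub =>
        (hsub (hDT _ hx x (by simp))).2 (.refl _)⟩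
    · intro y hy
      obtain ⟨z, hz, hyz⟩ := hst.exists_mem hy
      have hyz' : FEmb [y] [z] := .cons hyz .nil
      exact ⟨hD _ _ hyz' (ht z hz).1, fun h' => (ht z hz).2 (h'.trans hyz')⟩
  push Not at hlen
  obtain ⟨z, hz, hzlen⟩ := hlen
  by_cases happ : ∀ x ∈ D, ∀ y ∈ D, x ++ y ∈ D
  · exact h.bounded_of_append_closed hD ⟨z, hz⟩ happ ihx
  push Not at happ
  obtain ⟨x, hx, y, hy, hxy⟩ := happ
  have hD₂ : DownClosed {t ∈ D | t.length ≤ 1} := fun s t hst ht =>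
    ⟨hD _ _ hst ht.1, hst.length_le.trans ht.2⟩
  have h₂ : BoundedAlternation C {t ∈ D | t.length ≤ 1} :=
    ih _ hD₂ (fun t ht => ht.1) ⟨z, hz, fun h => by have := h.2; omega⟩
  have h₁₂ : BoundedAlternation C
      {t | ∃ a ∈ {t ∈ D | ¬ FEmb x t}, ∃ b ∈ {t ∈ D | t.length ≤ 1}, t = a ++ b} :=
    (ihx x hx).append h₂ h.append (DownClosed.not_above hD x) hD₂ fun t ht => ht
  refine h₁₂.append (ihx y hy) h.append (fun s t hst => ?_) (DownClosed.not_above hD y)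
    fun t ht => ?_
  · rintro ⟨a, ha, b, hb, rfl⟩
    obtain ⟨a', b', rfl, ha', hb'⟩ := hst.split_right
    exact ⟨a', DownClosed.not_above hD x _ _ ha' ha, b', hD₂ _ _ hb' hb, rfl⟩
  · have hnil : [] ∈ D := hD _ _ .nil hx
    -- Cut `t` at the tree `b` with which its prefix first contains `x`. The remainder `c` cannot
    -- contain `y`, since otherwise `x ++ y` would be in `D`.
    have hpre : ∀ t₁ t₂, t₁ ++ t₂ = t → ¬ FEmb x t₁ → ∃ a c : List (Tree A), ∃ b,
        t = a ++ b ++ c ∧ b.length ≤ 1 ∧ ¬ FEmb x a ∧ (c = [] ∨ FEmb x (a ++ b)) := by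
      intro t₁ t₂
      induction t₂ generalizing t₁ with
      | nil => exact fun h₁ h₂ => ⟨t₁, [], [], by simpa using h₁.symm, by simp, h₂, .inl rfl⟩
      | cons w t₂ ih =>
        intro h₁ h₂
        by_cases hx : FEmb x (t₁ ++ [w])
        · exact ⟨t₁, t₂, [w], by simpa using h₁.symm, by simp, h₂, .inr hx⟩
        · exact ih (t₁ ++ [w]) (by simpa using h₁) hx
    have hxnil : ¬ FEmb x [] := fun hx0 => by
      have := hx0.length_le
      obtain rfl : x = [] := List.length_eq_zero_iff.1 (by simpa using this)
      exact hxy (by simpa using hy)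
    obtain ⟨a, c, b, rfl, hb, ha, hc⟩ := hpre [] t rfl hxnil
    have haD : a ∈ D := hD _ _ (by simpa using FEmb.surround (l := []) (r := b ++ c) (.refl a)) ht
    have hbD : b ∈ D := hD _ _ (FEmb.surround (l := a) (r := c) (.refl b)) ht
    have hcD : c ∈ D := hD _ _ (by simpa using FEmb.surround (l := a ++ b) (r := []) (.refl c)) ht
    refine ⟨a ++ b, ⟨a, ⟨haD, ha⟩, b, ⟨hbD, hb⟩, rfl⟩, c, ⟨hcD, fun hyc => ?_⟩, rfl⟩
    rcases hc with rfl | hc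
    · obtain rfl : y = [] := List.length_eq_zero_iff.1 (by simpa using hyc.length_le)
      exact hxy (by simpa using hx)
    · exact hxy (hD _ _ (hc.append hyc) ht)

end PiecewiseCongruence

end ForestLang

namespace ForestLang

variable {A : Type*}

/-! ### Cca-pieces are homeomorphic embeddings -/

theorem FEmb.subst (p : Context A) {s t : Forest A} (h : FEmb (A := A) s t) :
    FEmb (A := A) (p.subst s) (p.subst t) := by
  induction p with
  | hole l r => exact ((FEmb.refl l).append h).append (FEmb.refl r)
  | node l a p r ih => exact ((FEmb.refl l).append (FEmb.node a ih)).append (FEmb.refl r)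

theorem letter_smul (a : A) (t : Forest A) :
    Context.letter a • t = ([Tree.node a t] : List (Tree A)) := by
  change Context.subst (Context.node 0 a (Context.hole 0 0) 0) t = _
  simp [Context.subst]
  rfl

theorem CCAStep.emb {s t : Forest A} (h : CCAStep s t) : FEmb (A := A) s t := by
  obtain ⟨p, a, t, ht, rfl, rfl⟩ := h
  rw [mul_smul, letter_smul]
  refine FEmb.subst p (.of_length_le_one a ?_ (.refl t))
  rcases ht with ⟨x, rfl⟩ | rfl
  · exact le_refl 1
  · exact Nat.zero_le 1

theorem CCAPiece.emb {s t : Forest A} (h : CCAPiece s t) : FEmb (A := A) s t := by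
  induction h with
  | refl => exact .refl _
  | tail _ h ih => exact FEmb.trans ih h.emb

theorem CCAPiece.smul (p : Context A) {s t : Forest A} (h : CCAPiece s t) :
    CCAPiece (p • s) (p • t) := by
  induction h with
  | refl => exact .refl
  | tail _ h ih =>
    obtain ⟨q, a, u, hu, rfl, rfl⟩ := h
    exact ih.tail ⟨p * q, a, u, hu, smul_smul _ _ _, by rw [smul_smul, mul_assoc]⟩

theorem CCAPiece.surround (l r : List (Tree A)) {s t : List (Tree A)}
    (h : CCAPiece (A := A) s t) : CCAPiece (A := A) (l ++ s ++ r) (l ++ t ++ r) :=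
  CCAPiece.smul (Context.hole l r) h

theorem CCAPiece.node (a : A) {s t : Forest A} (h : CCAPiece s t) :
    CCAPiece (A := A) [Tree.node a s] [Tree.node a t] := by
  have := CCAPiece.smul (Context.letter a) h
  rwa [letter_smul, letter_smul] at this

theorem CCAPiece.append {s s' t t' : List (Tree A)} (h : CCAPiece (A := A) s s')
    (h' : CCAPiece (A := A) t t') : CCAPiece (A := A) (s ++ t) (s' ++ t') := by
  have h1 := CCAPiece.surround [] t h
  have h2 := CCAPiece.surround s' [] h'
  simp only [List.nil_append, List.append_nil] at h1 h2
  exact h1.trans h2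

theorem CCAPiece.below (a : A) {t : Forest A} (ht : t.IsTree ∨ t = 0) :
    CCAPiece (A := A) t ([Tree.node a t] : List (Tree A)) := by
  refine .single ⟨1, a, t, ht, (one_smul _ _).symm, ?_⟩
  rw [one_mul, letter_smul]

theorem CCAPiece.nil (t : List (Tree A)) : CCAPiece (A := A) ([] : List (Tree A)) t := by
  induction hn : Tree.sizeList t using Nat.strong_induction_on generalizing t with
  | _ n ih =>
    subst hn
    rcases t with _ | ⟨⟨a, F⟩, t⟩
    · exact .refl
    · have hF := ih (Tree.sizeList F) (by simp [Tree.sizeList, Tree.size]; omega) F rfl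
      have ht := ih (Tree.sizeList t) (by simp [Tree.sizeList, Tree.size]) t rfl
      have h1 : CCAPiece (A := A) ([] : List (Tree A)) ([Tree.node a []] : List (Tree A)) :=
        CCAPiece.below a (.inr rfl)
      exact CCAPiece.append (s := []) (h1.trans (CCAPiece.node a hF)) ht

/-- When a tree `x` embeds below a root `a`, reduce the forest under `a` to `x` alone by induction;
`a` then has one child and may be removed. -/
theorem CCAPiece.of_emb {s t : List (Tree A)} (h : FEmb s t) : CCAPiece (A := A) s t := by
  induction hn : Tree.sizeList t using Nat.strong_induction_on generalizing s t with
  | _ n ih =>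
    subst hn
    cases h with
    | nil => exact CCAPiece.nil t
    | cons_right h =>
      rename_i x t
      have h1 := ih _ (by simpa [Tree.sizeList] using x.size_pos) h rfl
      exact CCAPiece.append (CCAPiece.nil [x]) h1
    | cons hr h =>
      rename_i x y s t
      have h1 := ih _ (by simpa [Tree.sizeList] using y.size_pos) h rfl
      refine CCAPiece.append (s := [x]) (s' := [y]) ?_ h1
      cases hr with
      | root a hF =>
        refine CCAPiece.node a (ih _ ?_ hF rfl)
        simp [Tree.sizeList, Tree.size]
        omega
      | desc a hm hr =>
        rename_i z F
        have hle := Tree.size_le_of_mem hm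
        have h2 : CCAPiece (A := A) ([x] : List (Tree A)) F :=
          ih _ (by simp [Tree.sizeList, Tree.size]; omega) (.singleton_of_mem hm hr) rfl
        have h3 : CCAPiece (A := A) ([x] : List (Tree A)) ([Tree.node a [x]] : List (Tree A)) :=
          CCAPiece.below a (.inl ⟨x, rfl⟩)
        exact h3.trans (CCAPiece.node a h2)

/-! ### Piecewise testability and congruences -/

theorem PiecewiseCongruence.isCCAPiecewiseTestable [Finite A]
    {C : List (Tree A) → List (Tree A) → Prop} (h : PiecewiseCongruence C) {L : Set (Forest A)}
    (hL : ∀ s t : List (Tree A), C s t → ((s : Forest A) ∈ L ↔ (t : Forest A) ∈ L)) :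
    IsCCAPiecewiseTestable L := by
  obtain ⟨N, hN⟩ := h.bounded.exists_size h.equiv
  refine ⟨N + 1, by omega, fun t t' htt' => hL t t' (hN t t' fun s hs => ?_)⟩
  have h' : (Forest.size (A := A) s ≤ N + 1 ∧ CCAPiece (A := A) s t) ↔
    (Forest.size (A := A) s ≤ N + 1 ∧ CCAPiece (A := A) s t') := Set.ext_iff.1 htt' s
  have hs' : Forest.size (A := A) s ≤ N + 1 := Nat.le_succ_of_le hs
  simp only [hs', true_and] at h'
  exact ⟨fun h => (h'.1 (.of_emb h)).emb, fun h => (h'.2 (.of_emb h)).emb⟩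

theorem finite_sizeList_le [Finite A] (n : ℕ) :
    {s : List (Tree A) | Tree.sizeList s ≤ n}.Finite := by
  induction n with
  | zero =>
    refine (Set.finite_singleton ([] : List (Tree A))).subset fun s hs => ?_
    rcases s with _ | ⟨x, s⟩
    · rfl
    · have := x.size_pos
      simp [Tree.sizeList] at hs
      omega
  | succ n ih =>
    refine (((Set.finite_univ (α := A)).prod (ih.prod ih)).image
      (fun x => Tree.node x.1 x.2.1 :: x.2.2)).insert [] |>.subset fun s hs => ?_
    rcases s with _ | ⟨⟨a, F⟩, s⟩
    · exact .inl rfl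
    · simp only [Set.mem_ofPred_eq, Tree.sizeList, Tree.size] at hs
      refine .inr ⟨(a, F, s), ⟨trivial, ?_, ?_⟩, rfl⟩ <;> simp only [Set.mem_ofPred_eq] <;> omega

/-- Membership in a piecewise testable language cannot alternate along an infinite chain. -/
theorem IsCCAPiecewiseTestable.iff_of_chain [Finite A] {L : Set (Forest A)}
    (hL : IsCCAPiecewiseTestable L) (a b : ℕ → List (Tree A)) {p q : Prop}
    (hab : ∀ i, FEmb (a i) (b i)) (hba : ∀ i, FEmb (b i) (a (i + 1)))
    (hp : ∀ i, (a (i + 1) : Forest A) ∈ L ↔ p) (hq : ∀ i, (b (i + 1) : Forest A) ∈ L ↔ q) :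
    p ↔ q := by
  obtain ⟨n, -, hn⟩ := hL
  by_contra hne
  -- If no small piece were new in the next `a`, then `a (i + 1)` and the `b (i + 1)` squeezed in
  -- between would have the same small pieces.
  have hlt : ∀ i, ∃ s, Tree.sizeList s ≤ n ∧ FEmb s (a (i + 1 + 1)) ∧ ¬ FEmb s (a (i + 1)) := by
    intro i
    by_contra hcon
    push Not at hcon
    refine hne ((hp i).symm.trans ((hn _ _ (Set.ext fun s => ?_)).trans (hq i)))
    exact and_congr_right fun hs => ⟨fun h => .of_emb (FEmb.trans h.emb (hab _)),
      fun h => .of_emb (hcon s hs (FEmb.trans h.emb (hba _)))⟩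
  choose s hs hs₁ hs₂ using hlt
  have hmono : ∀ i j, i ≤ j → FEmb (a i) (a j) := fun i j hij => by
    induction hij with
    | refl => exact .refl _
    | step _ ih => exact ih.trans ((hab _).trans (hba _))
  have hinj : ∀ i j, i < j → s i ≠ s j := fun i j hij h => by
    have h1 := (hs₁ i).trans (hmono (i + 1 + 1) (j + 1) (by omega))
    rw [h] at h1
    exact hs₂ j h1
  refine Set.infinite_of_injective_forall_mem (f := s) (fun i j h => ?_) hs (finite_sizeList_le n)
  rcases lt_trichotomy i j with h' | h' | h'
  · exact absurd h (hinj i j h')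
  · exact h'
  · exact absurd h.symm (hinj j i h')

end ForestLang

theorem Finite.exists_idempotent_index {F : Type*} [Finite F] (f : ℕ → F)
    (hf : ∀ i j, f i = f j → f (i + 1) = f (j + 1)) : ∃ k, 0 < k ∧ f (k + k) = f k := by
  obtain ⟨i, j, hne, hij⟩ := Finite.exists_ne_map_eq_of_infinite f
  wlog hlt : i < j generalizing i j
  · exact this j i hne.symm hij.symm (by omega)
  obtain ⟨d, rfl⟩ := Nat.exists_eq_add_of_lt hlt
  have hshift : ∀ m, f (i + m) = f (i + (d + 1) + m) := fun m => by
    induction m with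
    | zero => exact hij
    | succ m ih => exact hf _ _ ih
  have hmul : ∀ m n, f (i + n) = f (i + n + m * (d + 1)) := fun m n => by
    induction m with
    | zero => simp
    | succ m ih =>
      have h1 := hshift (n + m * (d + 1))
      rw [ih]
      convert h1 using 2 <;> ring
  -- A positive multiple of the period `d + 1` that is at least the preperiod `i`.
  refine ⟨(i + 1) * (d + 1), by positivity, ?_⟩
  obtain ⟨n, hn⟩ : ∃ n, (i + 1) * (d + 1) = i + n :=
    Nat.exists_eq_add_of_le (by nlinarith)
  have := hmul (i + 1) n
  rw [← hn] at this
  exact this.symm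

-- The algebraic characterization of testability.

namespace ForestLang

variable {A H V : Type*} [AddMonoid H] [Monoid V] [MulAction V H]

namespace FreeMorphism

/-- The value of a list of trees. -/
def val (α : FreeMorphism A H V) (s : List (Tree A)) : H := α.onForest s

/-- The image of the context `a □`. -/
def letter (α : FreeMorphism A H V) (a : A) : V := α.onContext (Context.letter a)

/-- The transformation of `H` defined by a composition of elementary contexts. -/
def eval (α : FreeMorphism A H V) (q : List (Step A)) (h : H) : H :=
  q.foldr (fun e h => α.letter e.2.1 • (α.val e.1 + h + α.val e.2.2)) h

variable (α : FreeMorphism A H V)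

@[simp] theorem val_nil : α.val [] = 0 := map_zero α.onForest

@[simp] theorem val_append (s t : List (Tree A)) : α.val (s ++ t) = α.val s + α.val t :=
  α.onForest.map_add' s t

@[simp] theorem val_node (a : A) (s : List (Tree A)) :
    α.val [.node a s] = α.letter a • α.val s :=
  (congrArg α.onForest (letter_smul a s)).symm.trans (α.map_smul (Context.letter a) s)

theorem val_cons (x : Tree A) (s : List (Tree A)) : α.val (x :: s) = α.val [x] + α.val s :=
  α.val_append [x] s

@[simp] theorem eval_nil (h : H) : α.eval [] h = h := rfl

@[simp] theorem eval_cons (e : Step A) (q : List (Step A)) (h : H) :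
    α.eval (e :: q) h = α.letter e.2.1 • (α.val e.1 + α.eval q h + α.val e.2.2) := rfl

theorem eval_append (p q : List (Step A)) (h : H) : α.eval (p ++ q) h = α.eval p (α.eval q h) := by
  simp [eval]

@[simp] theorem val_act (q : List (Step A)) (s : List (Tree A)) :
    α.val (act q s) = α.eval q (α.val s) := by
  induction q with
  | nil => rfl
  | cons e q ih => simp [Step.subst, ih, add_assoc]

theorem exists_smul_eq_eval [ForestAlgebra H V] (q : List (Step A)) :
    ∃ v : V, ∀ h : H, v • h = α.eval q h := by
  induction q with
  | nil => exact ⟨1, one_smul V⟩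
  | cons e q ih =>
    obtain ⟨v, hv⟩ := ih
    obtain ⟨l, hl⟩ := ForestAlgebra.exists_add_hole (V := V) (α.val e.1)
    obtain ⟨r, hr⟩ := ForestAlgebra.exists_hole_add (V := V) (α.val e.2.2)
    exact ⟨α.letter e.2.1 * r * l * v, fun h => by simp [mul_smul, hl, hr, hv]⟩

/-- The syntactic congruence of the language recognized by `α` and `X`. -/
def Congr (X : Set H) (s t : List (Tree A)) : Prop :=
  ∀ (l r : List (Tree A)) (q : List (Step A)),
    α.val (l ++ act q s ++ r) ∈ X ↔ α.val (l ++ act q t ++ r) ∈ X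

theorem congr_of_val_eq (X : Set H) {s t : List (Tree A)} (h : α.val s = α.val t) :
    α.Congr X s t := fun l r q => by simp [h]

theorem congr_equivalence (X : Set H) : Equivalence (α.Congr X) where
  refl _ _ _ _ := Iff.rfl
  symm h l r q := (h l r q).symm
  trans h h' l r q := (h l r q).trans (h' l r q)

theorem congr_surround {X : Set H} {s t : List (Tree A)} (h : α.Congr X s t)
    (x y : List (Tree A)) : α.Congr X (x ++ s ++ y) (x ++ t ++ y) := fun l r q => by
  -- The forests `x` and `y` are absorbed into the side forests of the innermost elementary context
  -- of `q`, or into `l` and `r` if there is none.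
  rcases List.eq_nil_or_concat q with rfl | ⟨q, e, rfl⟩
  · simpa using h (l ++ x) (y ++ r) []
  · have := h l r (q ++ [(e.1 ++ x, e.2.1, y ++ e.2.2)])
    simpa [act_append, Step.subst] using this

/-- The condition on forests for piecewise testability. -/
def ForestCondition (X : Set H) : Prop :=
  ∀ s z : List (Tree A), FEmb s z → α.val z + α.val z = α.val z →
    α.Congr X (z ++ s) z ∧ α.Congr X (s ++ z) z

/-- The condition on contexts for piecewise testability. -/
def ContextCondition (X : Set H) : Prop :=
  ∀ q p : List (Step A), CEmb q p → (∀ h : H, α.eval p (α.eval p h) = α.eval p h) →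
    ∀ t : List (Tree A), t.length ≤ 1 →
      α.Congr X (act (p ++ q) t) (act p t) ∧ α.Congr X (act (q ++ p) t) (act p t)

theorem piecewiseCongruence [Finite H] {X : Set H} (hf : α.ForestCondition X)
    (hc : α.ContextCondition X) : PiecewiseCongruence (α.Congr X) where
  equiv := α.congr_equivalence X
  append a a' b b' ha hb := by
    have h₁ := α.congr_surround ha [] b
    have h₂ := α.congr_surround hb a' []
    simp only [List.nil_append, List.append_nil] at h₁ h₂
    exact (α.congr_equivalence X).trans h₁ h₂
  node a s t h l r q := by
    have := h l r (q ++ [([], a, [])])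
    rw [act_append, act_append] at this
    simpa [Step.subst] using this
  finite_forest := ⟨Nat.card H, fun s => Finite.equivFin H (α.val s), fun s t h =>
    α.congr_of_val_eq X ((Finite.equivFin H).injective h)⟩
  finite_context := ⟨Nat.card (H → H), fun q => Finite.equivFin (H → H) (α.eval q),
    fun p q h s _ => α.congr_of_val_eq X (by
      rw [val_act, val_act, (Finite.equivFin (H → H)).injective h])⟩
  forest_identity z := by
    obtain ⟨k, hk, hkk⟩ := Finite.exists_idempotent_index (fun k => α.val (power k z))
      (fun i j h => by simp only [power.succ, val_append]; rw [h])
    refine ⟨k, fun s hs => hf s _ (hs.trans ?_) (by rw [← val_append, ← power.add]; exact hkk)⟩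
    obtain ⟨k, rfl⟩ := Nat.exists_eq_succ_of_ne_zero hk.ne'
    simpa using FEmb.surround (l := []) (r := power k z) (.refl z)
  context_identity p := by
    obtain ⟨k, hk, hkk⟩ := Finite.exists_idempotent_index (fun k => α.eval (power k p))
      (fun i j h => by funext x; simp only [power.succ, eval_append]; rw [h])
    refine ⟨k, fun q hq => hc q _ (hq.trans ?_)
      fun h => by rw [← eval_append, ← power.add]; exact congrFun hkk h⟩
    obtain ⟨k, rfl⟩ := Nat.exists_eq_succ_of_ne_zero hk.ne'
    simpa using (CEmb.refl p).append (.nil : CEmb [] (power k p))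

theorem val_power {z : List (Tree A)} (hz : α.val z + α.val z = α.val z) (i : ℕ) :
    α.val (power (i + 1) z) = α.val z := by
  induction i with
  | zero => simp
  | succ i ih => rw [power.succ, val_append, ih, hz]

theorem eval_power {p : List (Step A)} (hp : ∀ h, α.eval p (α.eval p h) = α.eval p h) (i : ℕ)
    (h : H) : α.eval (power (i + 1) p) h = α.eval p h := by
  induction i with
  | zero => simp
  | succ i ih => rw [power.succ, eval_append, ih, hp]

theorem iff_of_chain [Finite A] {X : Set H} (h : IsCCAPiecewiseTestable (α.language X))
    (a b : ℕ → List (Tree A)) {x y : H} (hab : ∀ i, FEmb (a i) (b i))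
    (hba : ∀ i, FEmb (b i) (a (i + 1))) (hx : ∀ i, α.val (a (i + 1)) = x)
    (hy : ∀ i, α.val (b (i + 1)) = y) : y ∈ X ↔ x ∈ X :=
  (h.iff_of_chain a b hab hba (fun i => by rw [← hx i]; rfl) (fun i => by rw [← hy i]; rfl)).symm

/-- Powers of `z` with and without the extra summand `s` interleave into one increasing chain. The
zeroth power is empty and may have another value, which is why `iff_of_chain` looks only at indices
`i + 1`. -/
theorem forestCondition_of_testable [Finite A] {X : Set H}
    (h : IsCCAPiecewiseTestable (α.language X)) : α.ForestCondition X := by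
  intro s z hs hz
  have hmono : ∀ (l r : List (Tree A)) (q : List (Step A)) {s t : List (Tree A)}, FEmb s t →
      FEmb (l ++ act q s ++ r) (l ++ act q t ++ r) := fun l r q _ _ h =>
    ((FEmb.refl l).append (h.act q)).append (FEmb.refl r)
  constructor <;> intro l r q
  · refine α.iff_of_chain h (fun i => l ++ act q (power i z) ++ r)
      (fun i => l ++ act q (power i z ++ s) ++ r) (fun i => hmono l r q ?_)
      (fun i => hmono l r q ?_) (fun i => ?_) (fun i => ?_)
    · simpa using FEmb.surround (l := []) (r := s) (.refl (power i z))
    · rw [power.add]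
      simpa using (FEmb.refl (power i z)).append hs
    · simp only [val_append, val_act, α.val_power hz]
    · simp only [val_append, val_act, α.val_power hz]
  · refine α.iff_of_chain h (fun i => l ++ act q (power i z) ++ r)
      (fun i => l ++ act q (s ++ power i z) ++ r) (fun i => hmono l r q ?_)
      (fun i => hmono l r q ?_) (fun i => ?_) (fun i => ?_)
    · simpa using FEmb.surround (l := s) (r := []) (.refl (power i z))
    · rw [power.succ]
      exact hs.append (FEmb.refl _)
    · simp only [val_append, val_act, α.val_power hz]
    · simp only [val_append, val_act, α.val_power hz]

theorem contextCondition_of_testable [Finite A] {X : Set H}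
    (h : IsCCAPiecewiseTestable (α.language X)) : α.ContextCondition X := by
  intro q p hq hp t ht
  have hmono : ∀ (l r : List (Tree A)) (w : List (Step A)) {p q : List (Step A)}, CEmb p q →
      FEmb (l ++ act w (act p t) ++ r) (l ++ act w (act q t) ++ r) := fun l r w _ _ h =>
    ((FEmb.refl l).append ((CEmb.act h ht (.refl t)).act w)).append (FEmb.refl r)
  constructor <;> intro l r w
  · refine α.iff_of_chain h (fun i => l ++ act w (act (power i p) t) ++ r)
      (fun i => l ++ act w (act (power i p ++ q) t) ++ r) (fun i => hmono l r w ?_)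
      (fun i => hmono l r w ?_) (fun i => ?_) (fun i => ?_)
    · simpa using (CEmb.refl (power i p)).append (.nil : CEmb [] q)
    · rw [power.add]
      simpa using (CEmb.refl (power i p)).append hq
    · simp only [val_append, val_act, α.eval_power hp]
    · simp only [val_append, val_act, eval_append, α.eval_power hp]
  · refine α.iff_of_chain h (fun i => l ++ act w (act (power i p) t) ++ r)
      (fun i => l ++ act w (act (q ++ power i p) t) ++ r) (fun i => hmono l r w ?_)
      (fun i => hmono l r w ?_) (fun i => ?_) (fun i => ?_)
    · simpa using (.nil : CEmb [] q).append (CEmb.refl (power i p))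
    · rw [power.succ]
      exact hq.append (CEmb.refl _)
    · simp only [val_append, val_act, α.eval_power hp]
    · simp only [val_append, val_act, eval_append, α.eval_power hp]

/-- The algebraic characterization of cca-piecewise testability. -/
theorem isCCAPiecewiseTestable_iff [Finite A] [Finite H] (X : Set H) :
    IsCCAPiecewiseTestable (α.language X) ↔ α.ForestCondition X ∧ α.ContextCondition X := by
  refine ⟨fun h => ⟨α.forestCondition_of_testable h, α.contextCondition_of_testable h⟩,
    fun ⟨hf, hc⟩ => (α.piecewiseCongruence hf hc).isCCAPiecewiseTestable fun s t h => ?_⟩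
  have := h [] [] []
  simp only [List.nil_append, List.append_nil, act_nil] at this
  exact this

/-! ### Finite certificates -/

/-- Relations on `H` and `V` that contain the values of all pairs of forests, of trees and of
contexts related by embedding, and a congruence that the accepting set respects and that contains
the identities of piecewise testability. -/
structure Certificate (X : Set H) (R₀ R₁ E : H → H → Prop) (S : V → V → Prop) : Prop where
  zero : R₁ 0 0
  of_tree : ∀ y x, R₁ y x → R₀ y x
  add : ∀ y x y' x', R₀ y x → R₀ y' x' → R₀ (y + y') (x + x')
  node : ∀ a y x, R₀ y x → R₁ (α.letter a • y) (α.letter a • x)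
  below : ∀ a y x, R₁ y x → R₁ y (α.letter a • x)
  add_right : ∀ y x y' x', R₁ y x → R₀ y' x' → R₁ y (x + x')
  add_left : ∀ y x y' x', R₁ y x → R₀ y' x' → R₁ y (x' + x)
  one : S 1 1
  mul : ∀ v u v' u', S v u → S v' u' → S (v * v') (u * u')
  step : ∀ a l l' r r' v u, R₀ l l' → R₀ r r' → (∀ h : H, v • h = α.letter a • (l + h + r)) →
    (∀ h : H, u • h = α.letter a • (l' + h + r')) → S v u
  -- As `α` need not be surjective, the reflexive pairs of `R₀` stand for values of forests, and
  -- those of `R₁` for values of forests with at most one root.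
  skip : ∀ a l r u, R₀ l l → R₀ r r → (∀ h : H, u • h = α.letter a • (l + h + r)) → S 1 u
  forest_right : ∀ y f, R₀ y f → f + f = f → E (f + y) f
  forest_left : ∀ y f, R₀ y f → f + f = f → E (y + f) f
  context_right : ∀ v u h, S v u → u * u = u → R₁ h h → E (u • v • h) (u • h)
  context_left : ∀ v u h, S v u → u * u = u → R₁ h h → E (v • u • h) (u • h)
  congr_right : ∀ x y g, E x y → R₀ g g → E (x + g) (y + g)
  congr_left : ∀ x y g, E x y → R₀ g g → E (g + x) (g + y)
  congr_node : ∀ a x y, E x y → E (α.letter a • x) (α.letter a • y)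
  sound : ∀ x y, E x y → (x ∈ X ↔ y ∈ X)

namespace Certificate

variable {α} {X : Set H} {R₀ R₁ E : H → H → Prop} {S : V → V → Prop}
  (c : α.Certificate X R₀ R₁ E S)

include c

theorem refl (t : List (Tree A)) : R₁ 0 (α.val t) ∧ R₀ (α.val t) (α.val t) := by
  induction hn : Tree.sizeList t using Nat.strong_induction_on generalizing t with
  | _ n ih =>
    subst hn
    rcases t with _ | ⟨⟨a, F⟩, t⟩
    · simpa using ⟨c.zero, c.of_tree _ _ c.zero⟩
    · obtain ⟨h₁, h₂⟩ := ih _ (by simp [Tree.sizeList, Tree.size]; omega) F rfl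
      obtain ⟨h₃, h₄⟩ := ih _ (by simp [Tree.sizeList, Tree.size]) t rfl
      rw [val_cons, val_node]
      exact ⟨c.add_right _ _ _ _ (c.below a _ _ h₁) h₄,
        c.add _ _ _ _ (c.of_tree _ _ (c.node a _ _ h₂)) h₄⟩

/-- The axioms mirror the rules that generate embeddings, so every certificate contains the values
of all embedded pairs. Larger relations only make the remaining axioms more demanding. -/
theorem of_emb {s t : List (Tree A)} (h : FEmb s t) :
    R₀ (α.val s) (α.val t) ∧ (s.length ≤ 1 → R₁ (α.val s) (α.val t)) := by
  induction hn : Tree.sizeList t using Nat.strong_induction_on generalizing s t with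
  | _ n ih =>
    subst hn
    cases h with
    | nil => simpa using ⟨c.of_tree _ _ (c.refl t).1, (c.refl t).1⟩
    | cons_right h =>
      rename_i x t
      obtain ⟨h₁, h₂⟩ := ih _ (by simpa [Tree.sizeList] using x.size_pos) h rfl
      rw [val_cons α x]
      refine ⟨?_, fun hs => c.add_left _ _ _ _ (h₂ hs) (c.refl [x]).2⟩
      simpa using c.add _ _ _ _ (c.of_tree _ _ (c.refl [x]).1) h₁
    | cons hr h =>
      rename_i x y s t
      obtain ⟨h₁, -⟩ := ih _ (by simpa [Tree.sizeList] using y.size_pos) h rfl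
      have h₂ : R₁ (α.val [x]) (α.val [y]) := by
        cases hr with
        | root a hF =>
          rw [val_node, val_node]
          exact c.node a _ _ (ih _ (by simp [Tree.sizeList, Tree.size]; omega) hF rfl).1
        | desc a hm hr =>
          rename_i z F
          rw [val_node]
          exact c.below a _ _ ((ih _ (by simp [Tree.sizeList, Tree.size]; omega)
            (s := [x]) (.singleton_of_mem hm hr) rfl).2 (by simp))
      rw [val_cons α x, val_cons α y]
      refine ⟨c.add _ _ _ _ (c.of_tree _ _ h₂) h₁, fun hs => ?_⟩
      obtain rfl : s = [] := List.length_eq_zero_iff.1 (by simpa using hs)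
      simpa using c.add_right _ _ _ _ h₂ (c.refl t).2

theorem of_cemb [ForestAlgebra H V] {q p : List (Step A)} (h : CEmb q p) :
    ∃ v u, (∀ h : H, v • h = α.eval q h) ∧ (∀ h : H, u • h = α.eval p h) ∧ S v u := by
  have hskip : ∀ (e : Step A) (p q : List (Step A)),
      (∃ v u, (∀ h : H, v • h = α.eval q h) ∧ (∀ h : H, u • h = α.eval p h) ∧ S v u) →
      ∃ v u, (∀ h : H, v • h = α.eval q h) ∧ (∀ h : H, u • h = α.eval (e :: p) h) ∧ S v u := by
    rintro e p q ⟨v, u, hv, hu, hvu⟩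
    obtain ⟨w, hw⟩ := α.exists_smul_eq_eval [e]
    refine ⟨1 * v, w * u, by simpa using hv, fun h => by rw [mul_smul, hu, hw]; rfl,
      c.mul _ _ _ _ (c.skip e.2.1 _ _ _ (c.refl e.1).2 (c.refl e.2.2).2 fun h => ?_) hvu⟩
    rw [hw]
    rfl
  induction h with
  | nil =>
    rename_i p
    induction p with
    | nil => exact ⟨1, 1, one_smul V, one_smul V, c.one⟩
    | cons e p ih => exact hskip e p _ ih
  | cons he _ ih =>
    rename_i e e' q p _
    obtain ⟨v, u, hv, hu, hvu⟩ := ih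
    obtain ⟨w, hw⟩ := α.exists_smul_eq_eval [e]
    obtain ⟨w', hw'⟩ := α.exists_smul_eq_eval [e']
    refine ⟨w * v, w' * u, fun h => by rw [mul_smul, hv, hw]; rfl,
      fun h => by rw [mul_smul, hu, hw']; rfl, c.mul _ _ _ _ ?_ hvu⟩
    refine c.step e'.2.1 _ _ _ _ _ _ (c.of_emb he.1).1 (c.of_emb he.2.2).1 (fun h => ?_)
      fun h => ?_
    · rw [hw, ← he.2.1]; rfl
    · rw [hw']; rfl
  | cons_right _ ih => exact hskip _ _ _ ih

theorem congr_of_val {s t : List (Tree A)} (h : E (α.val s) (α.val t)) : α.Congr X s t := by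
  intro l r q
  refine c.sound _ _ ?_
  have hq : E (α.eval q (α.val s)) (α.eval q (α.val t)) := by
    induction q with
    | nil => exact h
    | cons e q ih =>
      exact c.congr_node _ _ _ (c.congr_right _ _ _ (c.congr_left _ _ _ ih (c.refl _).2) (c.refl _).2)
  simp only [val_append, val_act]
  exact c.congr_right _ _ _ (c.congr_left _ _ _ hq (c.refl _).2) (c.refl _).2

end Certificate

/-- Piecewise testability is witnessed by finite certificates. -/
theorem isCCAPiecewiseTestable_iff_certificate [ForestAlgebra H V] [Finite A] [Finite H]
    (X : Set H) : IsCCAPiecewiseTestable (α.language X) ↔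
      ∃ (R₀ R₁ E : H → H → Prop) (S : V → V → Prop), α.Certificate X R₀ R₁ E S := by
  rw [isCCAPiecewiseTestable_iff]
  constructor
  · rintro ⟨hf, hc⟩
    have hpc := α.piecewiseCongruence hf hc
    -- The smallest candidates serve for `R₀`, `R₁` and `S`: the values of actual embedded pairs.
    -- For `E` take the values of congruent pairs.
    refine ⟨fun y x => ∃ s t, FEmb s t ∧ α.val s = y ∧ α.val t = x,
      fun y x => ∃ s t, FEmb s t ∧ α.val s = y ∧ α.val t = x ∧ s.length ≤ 1,
      fun x y => ∃ s t, α.Congr X s t ∧ α.val s = x ∧ α.val t = y,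
      fun v u => ∃ q p, CEmb q p ∧ (∀ h : H, v • h = α.eval q h) ∧ ∀ h : H, u • h = α.eval p h, ?_⟩
    constructor
    · exact ⟨[], [], .nil, by simp, by simp, by simp⟩
    · rintro _ _ ⟨s, t, h, rfl, rfl, -⟩
      exact ⟨s, t, h, rfl, rfl⟩
    · rintro _ _ _ _ ⟨s, t, h, rfl, rfl⟩ ⟨s', t', h', rfl, rfl⟩
      exact ⟨s ++ s', t ++ t', h.append h', by simp, by simp⟩
    · rintro a _ _ ⟨s, t, h, rfl, rfl⟩
      exact ⟨_, _, h.node a, by simp, by simp, by simp⟩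
    · rintro a _ _ ⟨s, t, h, rfl, rfl, hs⟩
      exact ⟨_, _, h.of_length_le_one a hs, by simp, by simp, hs⟩
    · rintro _ _ _ _ ⟨s, t, h, rfl, rfl, hs⟩ ⟨s', t', h', rfl, rfl⟩
      exact ⟨s, t ++ t', by simpa using FEmb.surround (l := []) (r := t') h, by simp, by simp, hs⟩
    · rintro _ _ _ _ ⟨s, t, h, rfl, rfl, hs⟩ ⟨s', t', h', rfl, rfl⟩
      exact ⟨s, t' ++ t, by simpa using FEmb.surround (l := t') (r := []) h, by simp, by simp, hs⟩
    · exact ⟨[], [], .nil, by simp, by simp⟩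
    · rintro v u v' u' ⟨q, p, h, hv, hu⟩ ⟨q', p', h', hv', hu'⟩
      exact ⟨q ++ q', p ++ p', h.append h', fun h => by rw [mul_smul, hv', hv, eval_append],
        fun h => by rw [mul_smul, hu', hu, eval_append]⟩
    · rintro a _ _ _ _ v u ⟨l, l', hl, rfl, rfl⟩ ⟨r, r', hr, rfl, rfl⟩ hv hu
      exact ⟨[(l, a, r)], [(l', a, r')], .cons ⟨hl, rfl, hr⟩ .nil, hv, hu⟩
    · rintro a _ _ u ⟨l, l', hl, rfl, hl'⟩ ⟨r, r', hr, rfl, hr'⟩ hu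
      exact ⟨[], [(l, a, r)], .nil, by simp, hu⟩
    · rintro _ _ ⟨s, t, h, rfl, rfl⟩ hid
      exact ⟨_, _, (hf s t h hid).1, by simp, rfl⟩
    · rintro _ _ ⟨s, t, h, rfl, rfl⟩ hid
      exact ⟨_, _, (hf s t h hid).2, by simp, rfl⟩
    · rintro v u _ ⟨q, p, h, hv, hu⟩ hid ⟨s, -, -, rfl, -, hs⟩
      have hp : ∀ h : H, α.eval p (α.eval p h) = α.eval p h := fun h => by
        rw [← hu, ← hu, ← mul_smul, hid]
      exact ⟨_, _, (hc q p h hp s hs).1, by simp [eval_append, hv, hu], by simp [hu]⟩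
    · rintro v u _ ⟨q, p, h, hv, hu⟩ hid ⟨s, -, -, rfl, -, hs⟩
      have hp : ∀ h : H, α.eval p (α.eval p h) = α.eval p h := fun h => by
        rw [← hu, ← hu, ← mul_smul, hid]
      exact ⟨_, _, (hc q p h hp s hs).2, by simp [eval_append, hv, hu], by simp [hu]⟩
    · rintro _ _ _ ⟨s, t, h, rfl, rfl⟩ ⟨g, -, -, rfl, -⟩
      exact ⟨_, _, hpc.append _ _ _ _ h (hpc.equiv.refl g), by simp, by simp⟩
    · rintro _ _ _ ⟨s, t, h, rfl, rfl⟩ ⟨g, -, -, rfl, -⟩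
      exact ⟨_, _, hpc.append _ _ _ _ (hpc.equiv.refl g) h, by simp, by simp⟩
    · rintro a _ _ ⟨s, t, h, rfl, rfl⟩
      exact ⟨_, _, hpc.node a _ _ h, by simp, by simp⟩
    · rintro _ _ ⟨s, t, h, rfl, rfl⟩
      simpa using h [] [] []
  · rintro ⟨R₀, R₁, E, S, c⟩
    refine ⟨fun s z hs hz => ⟨c.congr_of_val ?_, c.congr_of_val ?_⟩,
      fun q p hq hp t ht => ?_⟩
    · simpa using c.forest_right _ _ (c.of_emb hs).1 hz
    · simpa using c.forest_left _ _ (c.of_emb hs).1 hz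
    · obtain ⟨v, u, hv, hu, hvu⟩ := c.of_cemb hq
      -- Faithfulness turns idempotency of the action into idempotency in `V`, which the axioms
      -- mention.
      have hid : u * u = u := FaithfulSMul.eq_of_smul_eq_smul (α := H) fun h => by
        rw [mul_smul, hu, hu, hp]
      have hR := (c.of_emb (.refl t)).2 ht
      refine ⟨c.congr_of_val ?_, c.congr_of_val ?_⟩
      · simpa [eval_append, hv, hu] using c.context_right _ _ _ hvu hid hR
      · simpa [eval_append, hv, hu] using c.context_left _ _ _ hvu hid hR

end FreeMorphism

end ForestLang

namespace ForestLang

/-! ### A primitive recursive formula language -/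

namespace Input

/-- The number of elements of `H`. -/
def numForests (x : Input) : ℕ := x.1.length

/-- The number of elements of `V`. -/
def numContexts (x : Input) : ℕ := x.2.2.1.length

/-- The number of letters. -/
def numLetters (x : Input) : ℕ := x.2.2.2.2.2.1.length

end Input

/-- An entry of a table. -/
def entry (t : List (List ℕ)) (i j : ℕ) : ℕ := (t.getD i []).getD j 0

theorem entry_primrec {α : Type*} [Primcodable α] {t : α → List (List ℕ)} {i j : α → ℕ}
    (ht : Primrec t) (hi : Primrec i) (hj : Primrec j) :
    Primrec fun a => entry (t a) (i a) (j a) :=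
  (Primrec.list_getD 0).comp ((Primrec.list_getD []).comp ht hi) hj

/-- Membership of the pair `(i, j)` in the relation number `k` coded by `c`. -/
def Coded (c k i j : ℕ) : Prop := c.testBit (Nat.pair k (Nat.pair i j)) = true

theorem coded_primrec {α : Type*} [Primcodable α] {c i j : α → ℕ} (k : ℕ)
    (hc : Primrec c) (hi : Primrec i) (hj : Primrec j) :
    PrimrecPred fun a => Coded (c a) k (i a) (j a) := by
  have hpow : Primrec₂ fun a b : ℕ => a ^ b := Primrec₂.unpaired'.1 Nat.Primrec.pow
  have hpair : Primrec fun a => Nat.pair k (Nat.pair (i a) (j a)) :=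
    Primrec₂.natPair.comp (.const k) (Primrec₂.natPair.comp hi hj)
  refine PrimrecPred.of_eq (Primrec.eq.comp (Primrec.nat_mod.comp
    (Primrec.nat_div.comp hc (hpow.comp (.const 2) hpair)) (.const 2)) (.const 1)) fun a => ?_
  rw [Coded, Nat.testBit_eq_decide_div_mod_eq, decide_eq_true_iff]

/-- Terms for indices of elements of `H`, of `V` and of the alphabet. -/
inductive Term : Type
  | var (i : ℕ)
  | zero
  | one
  | add (s t : Term)
  | mul (s t : Term)
  | smul (s t : Term)
  | letter (s : Term)

/-- The value of a term under a list of values of the variables. -/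
def Term.eval (x : Input) (e : List ℕ) : Term → ℕ
  | var i => e.getD i 0
  | zero => x.2.1
  | one => x.2.2.2.1
  | add s t => entry x.1 (s.eval x e) (t.eval x e)
  | mul s t => entry x.2.2.1 (s.eval x e) (t.eval x e)
  | smul s t => entry x.2.2.2.2.1 (s.eval x e) (t.eval x e)
  | letter s => x.2.2.2.2.2.1.getD (s.eval x e) 0

theorem Term.primrec_eval (t : Term) :
    Primrec fun p : (Input × ℕ) × List ℕ => t.eval p.1.1 p.2 := by
  have hx : Primrec fun p : (Input × ℕ) × List ℕ => p.1.1 := Primrec.fst.comp Primrec.fst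
  have hx₂ := Primrec.snd.comp hx
  have hx₃ := Primrec.snd.comp hx₂
  have hx₄ := Primrec.snd.comp hx₃
  have hx₅ := Primrec.snd.comp hx₄
  have hx₆ := Primrec.snd.comp hx₅
  induction t with
  | var i => exact (Primrec.list_getD 0).comp Primrec.snd (.const i)
  | zero => exact Primrec.fst.comp hx₂
  | one => exact Primrec.fst.comp hx₄
  | add s t hs ht => exact entry_primrec (Primrec.fst.comp hx) hs ht
  | mul s t hs ht => exact entry_primrec (Primrec.fst.comp hx₃) hs ht
  | smul s t hs ht => exact entry_primrec (Primrec.fst.comp hx₅) hs ht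
  | letter s hs => exact (Primrec.list_getD 0).comp (Primrec.fst.comp hx₆) hs

/-- Formulas with quantifiers over the indices of elements of `H`, of `V` and of the alphabet. -/
inductive Formula : Type
  | eq (s t : Term)
  | rel (k : ℕ) (s t : Term)
  | accept (s : Term)
  | and (f g : Formula)
  | imp (f g : Formula)
  | iff (f g : Formula)
  | allForest (f : Formula)
  | allContext (f : Formula)
  | allLetter (f : Formula)

/-- Truth of a formula, for the relations coded by `c`. -/
def Formula.Holds (x : Input) (c : ℕ) : Formula → List ℕ → Prop
  | eq s t, e => s.eval x e = t.eval x e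
  | rel k s t, e => Coded c k (s.eval x e) (t.eval x e)
  | accept s, e => x.2.2.2.2.2.2.getD (s.eval x e) false = true
  | and f g, e => f.Holds x c e ∧ g.Holds x c e
  | imp f g, e => f.Holds x c e → g.Holds x c e
  | iff f g, e => f.Holds x c e ↔ g.Holds x c e
  | allForest f, e => ∀ i < x.numForests, f.Holds x c (i :: e)
  | allContext f, e => ∀ i < x.numContexts, f.Holds x c (i :: e)
  | allLetter f, e => ∀ i < x.numLetters, f.Holds x c (i :: e)

theorem primrecPred_forall_lt {α : Type*} [Primcodable α] {n : α → ℕ} {p : ℕ → α → Prop}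
    (hn : Primrec n) (hp : PrimrecPred fun a : ℕ × α => p a.1 a.2) :
    PrimrecPred fun a => ∀ i < n a, p i a := by
  have h : PrimrecRel p := hp
  exact (h.forall_mem_list.comp (Primrec.list_range.comp hn) .id).of_eq fun a => by simp

theorem primrecPred_exists_lt {α : Type*} [Primcodable α] {n : α → ℕ} {p : ℕ → α → Prop}
    (hn : Primrec n) (hp : PrimrecPred fun a : ℕ × α => p a.1 a.2) :
    PrimrecPred fun a => ∃ i < n a, p i a := by
  have h : PrimrecRel p := hp
  exact (h.exists_mem_list.comp (Primrec.list_range.comp hn) .id).of_eq fun a => by simp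

/-- All quantifiers are bounded by lengths of tables, so one structural induction covers every axiom
of a certificate. -/
theorem Formula.primrecPred_holds (f : Formula) :
    PrimrecPred fun p : (Input × ℕ) × List ℕ => f.Holds p.1.1 p.1.2 p.2 := by
  have hx : Primrec fun p : (Input × ℕ) × List ℕ => p.1.1 := Primrec.fst.comp Primrec.fst
  have hx₃ := Primrec.snd.comp (Primrec.snd.comp hx)
  have hx₆ := Primrec.snd.comp (Primrec.snd.comp (Primrec.snd.comp hx₃))
  have hcons : Primrec fun p : ℕ × ((Input × ℕ) × List ℕ) => (p.2.1, p.1 :: p.2.2) :=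
    (Primrec.fst.comp Primrec.snd).pair
      (Primrec.list_cons.comp Primrec.fst (Primrec.snd.comp Primrec.snd))
  induction f with
  | eq s t => exact Primrec.eq.comp s.primrec_eval t.primrec_eval
  | rel k s t =>
    exact coded_primrec k (Primrec.snd.comp Primrec.fst) s.primrec_eval t.primrec_eval
  | accept s =>
    exact Primrec.eq.comp ((Primrec.list_getD false).comp (Primrec.snd.comp hx₆) s.primrec_eval)
      (.const true)
  | and f g hf hg => exact hf.and hg
  | imp f g hf hg => exact (hf.not.or hg).of_eq fun _ => imp_iff_not_or.symm
  | iff f g hf hg =>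
    exact ((hf.not.or hg).and (hg.not.or hf)).of_eq fun _ => by
      rw [← imp_iff_not_or, ← imp_iff_not_or]
      exact iff_iff_implies_and_implies.symm
  | allForest f hf =>
    exact primrecPred_forall_lt (p := fun i p => f.Holds p.1.1 p.1.2 (i :: p.2))
      (Primrec.list_length.comp (Primrec.fst.comp hx)) (hf.comp hcons)
  | allContext f hf =>
    exact primrecPred_forall_lt (p := fun i p => f.Holds p.1.1 p.1.2 (i :: p.2))
      (Primrec.list_length.comp (Primrec.fst.comp hx₃)) (hf.comp hcons)
  | allLetter f hf =>
    exact primrecPred_forall_lt (p := fun i p => f.Holds p.1.1 p.1.2 (i :: p.2))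
      (Primrec.list_length.comp (Primrec.fst.comp hx₆)) (hf.comp hcons)

/-- A bound for the codes of quadruples of relations. -/
def Input.bound (x : Input) : ℕ :=
  -- Relation numbers are below 4, and indices for `H` and for `V` are below the sum of the two
  -- sizes. Pairing is monotone, so every relevant bit lies below this exponent.
  2 ^ Nat.pair 4 (Nat.pair (x.numForests + x.numContexts) (x.numForests + x.numContexts))

/-- Some code of relations satisfies the formula. -/
def Formula.Satisfiable (f : Formula) (x : Input) : Prop := ∃ c < x.bound, f.Holds x c []

theorem Formula.primrecPred_satisfiable (f : Formula) : PrimrecPred f.Satisfiable := by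
  have hpow : Primrec₂ fun a b : ℕ => a ^ b := Primrec₂.unpaired'.1 Nat.Primrec.pow
  have hn : Primrec fun x : Input => x.numForests + x.numContexts :=
    Primrec.nat_add.comp (Primrec.list_length.comp Primrec.fst)
      (Primrec.list_length.comp (Primrec.fst.comp (Primrec.snd.comp Primrec.snd)))
  have hb : Primrec Input.bound := hpow.comp (.const 2)
    (Primrec₂.natPair.comp (.const 4) (Primrec₂.natPair.comp hn hn))
  exact primrecPred_exists_lt (p := fun c x => f.Holds x c []) hb
    (f.primrecPred_holds.comp ((Primrec.snd.pair Primrec.fst).pair (.const [])))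

namespace Formula

open Term

/-- The formula that expresses the axioms of certificates, where the relations `R₀`, `R₁`, `E` and
`S` have the numbers 0, 1, 2 and 3. -/
def certificate : Formula :=
  let R₀ := rel 0
  let R₁ := rel 1
  let E := rel 2
  let S := rel 3
  -- Variables are de Bruijn indices: `x 0` is bound by the innermost quantifier.
  let x := var
  .and (R₁ .zero .zero) <|
  .and (allForest <| allForest <| imp (R₁ (x 1) (x 0)) (R₀ (x 1) (x 0))) <|
  .and (allForest <| allForest <| allForest <| allForest <|
    imp (R₀ (x 3) (x 2)) <| imp (R₀ (x 1) (x 0)) <| R₀ (.add (x 3) (x 1)) (.add (x 2) (x 0))) <|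
  .and (allLetter <| allForest <| allForest <|
    imp (R₀ (x 1) (x 0)) <| R₁ (.smul (letter (x 2)) (x 1)) (.smul (letter (x 2)) (x 0))) <|
  .and (allLetter <| allForest <| allForest <|
    imp (R₁ (x 1) (x 0)) <| R₁ (x 1) (.smul (letter (x 2)) (x 0))) <|
  .and (allForest <| allForest <| allForest <| allForest <|
    imp (R₁ (x 3) (x 2)) <| imp (R₀ (x 1) (x 0)) <| R₁ (x 3) (.add (x 2) (x 0))) <|
  .and (allForest <| allForest <| allForest <| allForest <|
    imp (R₁ (x 3) (x 2)) <| imp (R₀ (x 1) (x 0)) <| R₁ (x 3) (.add (x 0) (x 2))) <|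
  .and (S .one .one) <|
  .and (allContext <| allContext <| allContext <| allContext <|
    imp (S (x 3) (x 2)) <| imp (S (x 1) (x 0)) <| S (.mul (x 3) (x 1)) (.mul (x 2) (x 0))) <|
  .and (allLetter <| allForest <| allForest <| allForest <| allForest <| allContext <| allContext <|
    imp (R₀ (x 5) (x 4)) <| imp (R₀ (x 3) (x 2)) <|
    -- The inner quantifier shifts the outer variables by one: `x 2` here is the context called `x
    -- 1` in the conclusion.
    imp (allForest <| .eq (.smul (x 2) (x 0))
      (.smul (letter (x 7)) (.add (.add (x 6) (x 0)) (x 4)))) <|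
    imp (allForest <| .eq (.smul (x 1) (x 0))
      (.smul (letter (x 7)) (.add (.add (x 5) (x 0)) (x 3)))) <| S (x 1) (x 0)) <|
  .and (allLetter <| allForest <| allForest <| allContext <|
    imp (R₀ (x 2) (x 2)) <| imp (R₀ (x 1) (x 1)) <|
    imp (allForest <| .eq (.smul (x 1) (x 0))
      (.smul (letter (x 4)) (.add (.add (x 3) (x 0)) (x 2)))) <| S .one (x 0)) <|
  .and (allForest <| allForest <| imp (R₀ (x 1) (x 0)) <| imp (.eq (.add (x 0) (x 0)) (x 0)) <|
    E (.add (x 0) (x 1)) (x 0)) <|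
  .and (allForest <| allForest <| imp (R₀ (x 1) (x 0)) <| imp (.eq (.add (x 0) (x 0)) (x 0)) <|
    E (.add (x 1) (x 0)) (x 0)) <|
  .and (allContext <| allContext <| allForest <| imp (S (x 2) (x 1)) <|
    imp (.eq (.mul (x 1) (x 1)) (x 1)) <| imp (R₁ (x 0) (x 0)) <|
    E (.smul (x 1) (.smul (x 2) (x 0))) (.smul (x 1) (x 0))) <|
  .and (allContext <| allContext <| allForest <| imp (S (x 2) (x 1)) <|
    imp (.eq (.mul (x 1) (x 1)) (x 1)) <| imp (R₁ (x 0) (x 0)) <|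
    E (.smul (x 2) (.smul (x 1) (x 0))) (.smul (x 1) (x 0))) <|
  .and (allForest <| allForest <| allForest <| imp (E (x 2) (x 1)) <| imp (R₀ (x 0) (x 0)) <|
    E (.add (x 2) (x 0)) (.add (x 1) (x 0))) <|
  .and (allForest <| allForest <| allForest <| imp (E (x 2) (x 1)) <| imp (R₀ (x 0) (x 0)) <|
    E (.add (x 0) (x 2)) (.add (x 0) (x 1))) <|
  .and (allLetter <| allForest <| allForest <| imp (E (x 1) (x 0)) <|
    E (.smul (letter (x 2)) (x 1)) (.smul (letter (x 2)) (x 0))) <|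
  allForest <| allForest <| imp (E (x 1) (x 0)) <| .iff (accept (x 1)) (accept (x 0))

end Formula

/-! ### Inputs that describe morphisms -/

section

variable {A H V : Type*} [AddMonoid H] [Monoid V] [MulAction V H] {k n m : ℕ}
  (letters : Fin k ≃ A) (forests : Fin n ≃ H) (contexts : Fin m ≃ V) (α : FreeMorphism A H V)
  (X : Set H)

theorem forall_lt_iff_of_equiv {β : Type*} {n : ℕ} (e : Fin n ≃ β) {p : ℕ → Prop} :
    (∀ i < n, p i) ↔ ∀ b, p (e.symm b) :=
  ⟨fun h b => h _ (e.symm b).2, fun h i hi => by simpa using h (e ⟨i, hi⟩)⟩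

theorem getD_ofFn {β : Type*} {n : ℕ} (f : Fin n → β) (d : β) (i : Fin n) :
    (List.ofFn f).getD i d = f i := by
  simp [List.getD_eq_getElem?_getD]

theorem entry_ofFn {n m : ℕ} (f : Fin n → Fin m → ℕ) (i : Fin n) (j : Fin m) :
    entry (List.ofFn fun i => List.ofFn fun j => f i j) i j = f i j := by
  rw [entry, getD_ofFn, getD_ofFn]

theorem FreeMorphism.holds_certificate_iff (c : ℕ) :
    Formula.certificate.Holds (α.toInput letters forests contexts X) c [] ↔
      α.Certificate X (fun y x => Coded c 0 (forests.symm y) (forests.symm x))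
        (fun y x => Coded c 1 (forests.symm y) (forests.symm x))
        (fun y x => Coded c 2 (forests.symm y) (forests.symm x))
        (fun v u => Coded c 3 (contexts.symm v) (contexts.symm u)) := by
  set x := α.toInput letters forests contexts X with hx
  have hn : x.numForests = n := List.length_ofFn
  have hm : x.numContexts = m := List.length_ofFn
  have hk : x.numLetters = k := List.length_ofFn
  have hzero : x.2.1 = forests.symm 0 := rfl
  have hone : x.2.2.2.1 = contexts.symm 1 := rfl
  have hadd : ∀ y z : H, entry x.1 (forests.symm y) (forests.symm z) = forests.symm (y + z) :=
    fun y z => (entry_ofFn _ _ _).trans (by simp)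
  have hmul : ∀ u v : V,
      entry x.2.2.1 (contexts.symm u) (contexts.symm v) = contexts.symm (u * v) :=
    fun u v => (entry_ofFn _ _ _).trans (by simp)
  have hsmul : ∀ (v : V) (y : H),
      entry x.2.2.2.2.1 (contexts.symm v) (forests.symm y) = forests.symm (v • y) :=
    fun v y => (entry_ofFn _ _ _).trans (by simp)
  have hletter : ∀ a : A, x.2.2.2.2.2.1.getD (letters.symm a) 0 = contexts.symm (α.letter a) :=
    fun a => (getD_ofFn _ _ _).trans (by simp [FreeMorphism.letter])
  have haccept : ∀ y : H, x.2.2.2.2.2.2.getD (forests.symm y) false = true ↔ y ∈ X :=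
    fun y => by
      have : x.2.2.2.2.2.2.getD (forests.symm y) false = _ := getD_ofFn _ _ _
      rw [this]
      simp
  -- From here on only the lookup equations matter, which translate table entries into operations of
  -- the algebra.
  clear_value x
  simp only [Formula.certificate, Formula.Holds, Term.eval, hn, hm, hk,
    forall_lt_iff_of_equiv forests, forall_lt_iff_of_equiv contexts,
    forall_lt_iff_of_equiv letters, List.getD_cons_zero, List.getD_cons_succ, hzero, hone, hadd,
    hmul, hsmul, hletter, haccept, Fin.val_inj, EmbeddingLike.apply_eq_iff_eq]
  constructor
  · rintro ⟨h₁, h₂, h₃, h₄, h₅, h₆, h₇, h₈, h₉, h₁₀, h₁₁, h₁₂, h₁₃, h₁₄, h₁₅, h₁₆, h₁₇, h₁₈, h₁₉⟩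
    exact ⟨h₁, h₂, h₃, h₄, h₅, h₆, h₇, h₈, h₉, h₁₀, h₁₁, h₁₂, h₁₃, h₁₄, h₁₅, h₁₆, h₁₇, h₁₈, h₁₉⟩
  · rintro ⟨h₁, h₂, h₃, h₄, h₅, h₆, h₇, h₈, h₉, h₁₀, h₁₁, h₁₂, h₁₃, h₁₄, h₁₅, h₁₆, h₁₇, h₁₈, h₁₉⟩
    exact ⟨h₁, h₂, h₃, h₄, h₅, h₆, h₇, h₈, h₉, h₁₀, h₁₁, h₁₂, h₁₃, h₁₄, h₁₅, h₁₆, h₁₇, h₁₈, h₁₉⟩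

/-- Every four binary relations on initial segments of `ℕ` have a common code. -/
theorem exists_coded (N : ℕ) (R : ℕ → ℕ → ℕ → Prop) :
    ∃ c < 2 ^ Nat.pair 4 (Nat.pair N N), ∀ k < 4, ∀ i < N, ∀ j < N, Coded c k i j ↔ R k i j := by
  classical
  refine ⟨Nat.ofBits fun b : Fin (Nat.pair 4 (Nat.pair N N)) =>
    decide (R b.1.unpair.1 b.1.unpair.2.unpair.1 b.1.unpair.2.unpair.2), Nat.ofBits_lt_two_pow _,
    fun k hk i hi j hj => ?_⟩
  have hlt : Nat.pair k (Nat.pair i j) < Nat.pair 4 (Nat.pair N N) :=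
    (Nat.pair_lt_pair_left _ hk).trans (Nat.pair_lt_pair_right _
      ((Nat.pair_lt_pair_left _ hi).trans (Nat.pair_lt_pair_right _ hj)))
  rw [Coded, Nat.testBit_ofBits_lt _ _ hlt]
  simp

theorem FreeMorphism.satisfiable_certificate_iff :
    Formula.certificate.Satisfiable (α.toInput letters forests contexts X) ↔
      ∃ (R₀ R₁ E : H → H → Prop) (S : V → V → Prop), α.Certificate X R₀ R₁ E S := by
  constructor
  · rintro ⟨c, -, hc⟩
    exact ⟨_, _, _, _, (α.holds_certificate_iff letters forests contexts X c).1 hc⟩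
  · rintro ⟨R₀, R₁, E, S, h⟩
    let onForests (R : H → H → Prop) (i j : ℕ) : Prop :=
      ∃ y z, i = forests.symm y ∧ j = forests.symm z ∧ R y z
    let onContexts (i j : ℕ) : Prop :=
      ∃ u v, i = contexts.symm u ∧ j = contexts.symm v ∧ S u v
    obtain ⟨c, hc, hcR⟩ := exists_coded (n + m) fun k => match k with
      | 0 => onForests R₀
      | 1 => onForests R₁
      | 2 => onForests E
      | _ => onContexts
    have hn : (α.toInput letters forests contexts X).numForests = n := List.length_ofFn
    have hm : (α.toInput letters forests contexts X).numContexts = m := List.length_ofFn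
    refine ⟨c, by rwa [Input.bound, hn, hm],
      (α.holds_certificate_iff letters forests contexts X c).2 ?_⟩
    have hlt : ∀ y : H, (forests.symm y : ℕ) < n + m := fun y => by
      have := (forests.symm y).2
      omega
    have hlt' : ∀ v : V, (contexts.symm v : ℕ) < n + m := fun v => by
      have := (contexts.symm v).2
      omega
    have hforest : ∀ R y z, onForests R (forests.symm y) (forests.symm z) ↔ R y z :=
      fun R y z => by simp [onForests, Fin.val_inj]
    have hcontext : ∀ u v, onContexts (contexts.symm u) (contexts.symm v) ↔ S u v :=
      fun u v => by simp [onContexts, Fin.val_inj]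
    convert h using 1
    · ext y z
      exact (hcR 0 (by omega) _ (hlt y) _ (hlt z)).trans (hforest R₀ y z)
    · ext y z
      exact (hcR 1 (by omega) _ (hlt y) _ (hlt z)).trans (hforest R₁ y z)
    · ext y z
      exact (hcR 2 (by omega) _ (hlt y) _ (hlt z)).trans (hforest E y z)
    · ext u v
      exact (hcR 3 (by omega) _ (hlt' u) _ (hlt' v)).trans (hcontext u v)

end

end ForestLang

theorem mainTheorem5 :
    ∃ D : ForestLang.Input → Prop, ComputablePred D ∧
      ∀ (A H V : Type*) [AddMonoid H] [Monoid V] [MulAction V H] [ForestLang.ForestAlgebra H V]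
        (k n m : ℕ) (letters : Fin k ≃ A) (forests : Fin n ≃ H) (contexts : Fin m ≃ V)
        (α : ForestLang.FreeMorphism A H V) (X : Set H),
        D (α.toInput letters forests contexts X) ↔
          ForestLang.IsCCAPiecewiseTestable (α.language X) := by
  refine ⟨ForestLang.Formula.certificate.Satisfiable,
    ForestLang.Formula.certificate.primrecPred_satisfiable.computablePred, ?_⟩
  intro A H V _ _ _ _ k n m letters forests contexts α X
  have : Finite A := Finite.of_equiv _ letters
  have : Finite H := Finite.of_equiv _ forests
  rw [α.satisfiable_certificate_iff, α.isCCAPiecewiseTestable_iff_certificate]
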